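/- Let $\Gamma=\partial\Omega\subset\mathbb R^3$ be a closed (compact, without boundary) embedded $C^2$ surface, where $\Omega$ is the bounded open set it encloses. Let $d$ be the signed distance to $\Gamma$, negative in $\Omega$, let $\nu=\nabla d$ (on $\Gamma$ the outer unit normal, near $\Gamma$ its extension constant along normal lines), and let $\mathcal A=\nabla\nu=D^2d$ be the extended Weingarten map. The lift $x^\ell\in\Gamma$ of a point $x$ is the solution $p\in\Gamma$ of $p=x-d(x)\nu(p)$; for $v:\Gamma\to\mathbb R$ the unlift is $v^{-\ell}(x)=v(x^\ell)$. A finite conforming triangulated surface $\Gamma_h\subset\mathbb R^3$ is called admissible with constant $\varrho$ if $h_T\le\varrho\, r_T$ for each of its triangles $T$ ($h_T$ the longest edge, $r_T$ the inradius), all its vertices lie on $\Gamma$, and it covers $\Gamma$ exactly once, i.e. every point of $\Gamma$ is the lift of exactly one point of $\Gamma_h$. Put $h=\max_T h_T$, and let $\nu_h$ be a unit normal field of $\Gamma_h$ (given in the interiors of the triangles), $P_h=I-\nu_h\nu_h^T$, and $\sigma,\sigma_h$ the surface measures of $\Gamma,\Gamma_h$. Let $\mu_h=d\sigma/d\sigma_h$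 be the density with respect to $\sigma_h$ of $\sigma$ transported to $\Gamma_h$ by the inverse of the lift. For $x\in\Gamma_h$, with $\nu$ taken at $x^\ell$ and $d,\mathcal A$ taken at $x$, set $$\tilde R_h=\mu_h P_h\Big(I-\frac{\nu_h\nu^T}{\nu_h\cdot\nu}\Big)^{T}(I-d\mathcal A)^{-1}(I-d\mathcal A)^{-1}\Big(I-\frac{\nu_h\nu^T}{\nu_h\cdot\nu}\Big),\qquad \tilde A_h=\tilde R_hP_h .$$ For a surface $S$ with unit normal $n$, $H^1(S)$ denotes the completion of the $C^1$ functions in the $H^1$ norm, the tangential gradient of a $C^1$ function $\varphi$ being $\nabla_S\varphi=\nabla\varphi-(n\cdot\nabla\varphi)n$ and that of an $H^1$ function being the $L^2$ limit. Then for every $\Gamma$ and every $\varrho$ there is $h_0>0$ such that, for every admissible $\Gamma_h$ with constant $\varrho$ and $h\le h_0$, the quantities above are well defined (each $x\in\Gamma_h$ has exactly one lift, $I-d\mathcal A$ is invertible on $\Gamma_h$, $\nu_h\cdot\nu\ne0$ in the interiors of the triangles, and the transported measure is absolutely continuous with respect to $\sigma_h$), and, for all $v,w\in H^1(\Gamma)$,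 one has $v^{-\ell},w^{-\ell}\in H^1(\Gamma_h)$, both integrands below are integrable, and $$\int_\Gamma\nabla_\Gamma v\cdot\nabla_\Gamma w\,d\sigma=\int_{\Gamma_h}\tilde A_h\,\nabla_{\Gamma_h}v^{-\ell}\cdot\nabla_{\Gamma_h}w^{-\ell}\,d\sigma_h .$$ -/

import Mathlib

open MeasureTheory Filter Topology
open scoped RealInnerProductSpace Gradient ENNReal

noncomputable section

/-- Ambient Euclidean space `ℝ³`. -/
abbrev E3 : Type := EuclideanSpace ℝ (Fin 3)

/-- The surface measure on a set `S ⊆ ℝ³`: two-dimensional Hausdorff measure (normalised so that it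
agrees with Lebesgue measure on planes), restricted to `S`. -/
def surfaceMeasure (S : Set E3) : Measure E3 := μHE[2].restrict S

/-- The rank one matrix `a bᵀ`, i.e. `z ↦ (b · z) a`. -/
def outerProd (a b : E3) : E3 →L[ℝ] E3 := InnerProductSpace.rankOne ℝ a b

/-- `I - n nᵀ`; for a unit vector `n` the orthogonal projection onto the plane orthogonal to `n`. -/
def tangentialProj (n : E3) : E3 →L[ℝ] E3 := 1 - outerProd n n

/-- The `H¹` functions and their tangential gradients on a surface `S ⊆ ℝ³` with unit normal field
`n`: `H¹(S)` is the completion of the `C¹` functions on `S` in the `H¹` norm, where the tangential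
gradient of a `C¹` function `φ` is `∇φ - (n · ∇φ) n`.  Thus `v ∈ L²(S)` is in `H¹(S)`, with
tangential gradient `g ∈ L²(S; ℝ³)`, iff some sequence of `C¹` functions `φ k` satisfies
`φ k → v` and `∇φ k - (n · ∇φ k) n → g` in `L²(S)`.
Functions on `S` are represented by functions on `ℝ³`; their values off `S` play no role. -/
structure HasTangentialGradient (S : Set E3) (n : E3 → E3) (v : E3 → ℝ) (g : E3 → E3) : Prop where
  memLp : MemLp v 2 (surfaceMeasure S)
  memLp_grad : MemLp g 2 (surfaceMeasure S)
  approx : ∃ φ : ℕ → E3 → ℝ, (∀ k, ContDiff ℝ 1 (φ k)) ∧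
    Tendsto (fun k => eLpNorm (fun x => φ k x - v x) 2 (surfaceMeasure S)) atTop (𝓝 0) ∧
    Tendsto (fun k => eLpNorm (fun x => tangentialProj (n x) (∇ (φ k) x) - g x) 2
      (surfaceMeasure S)) atTop (𝓝 0)

/-- A closed (compact, without boundary) embedded `C²` surface in `ℝ³`, presented by the bounded open
set `inside` that it bounds: locally, `inside` is the negativity set of a `C²` function with
nonvanishing derivative.  The surface itself is `carrier`; it need not be connected. -/
structure ClosedC2Surface where
  inside : Set E3
  isOpen_inside : IsOpen inside
  isBounded_inside : Bornology.IsBounded inside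
  exists_defining : ∀ p ∈ frontier inside, ∃ (U : Set E3) (φ : E3 → ℝ), IsOpen U ∧ p ∈ U ∧
    ContDiffOn ℝ 2 φ U ∧ (∀ x ∈ U, fderiv ℝ φ x ≠ 0) ∧ inside ∩ U = {x ∈ U | φ x < 0}

namespace ClosedC2Surface

variable (Γ : ClosedC2Surface)

/-- The surface as a set of points. -/
def carrier : Set E3 := frontier Γ.inside

open Classical in
/-- The signed distance function `d` of the surface, negative inside. -/
def signedDist (x : E3) : ℝ :=
  if x ∈ Γ.inside then -Metric.infDist x Γ.carrier else Metric.infDist x Γ.carrier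

/-- `ν = ∇d`: on the surface it is the outer unit normal, near the surface it is the extension of
the outer unit normal that is constant along normal lines. -/
def normal (x : E3) : E3 := ∇ Γ.signedDist x

/-- The extended Weingarten map `𝒜 = ∇ν = D²d`. -/
def weingarten (x : E3) : E3 →L[ℝ] E3 := fderiv ℝ Γ.normal x

/-- `p` is a lift of `x`: a point of the surface with `p = x - d(x) ν(p)`. -/
def IsLift (x p : E3) : Prop := p ∈ Γ.carrier ∧ p = x - Γ.signedDist x • Γ.normal p

/-- The lift `x ↦ xˡ`, for points `x` that have exactly one lift. -/
def lift (x : E3) : E3 := Classical.epsilon (Γ.IsLift x)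

end ClosedC2Surface

/-- The triangles (with an ordering of their vertices) of a simplicial complex in `ℝ³`. -/
def triangles (K : Geometry.SimplicialComplex ℝ E3) : Set (Affine.Triangle ℝ E3) :=
  {t | ∃ s ∈ K.faces, (s : Set E3) = Set.range t.points}

/-- `h_T`, the maximal edge length of a triangle. -/
def maxEdge (t : Affine.Triangle ℝ E3) : ℝ := Metric.diam (Set.range t.points)

/-- The mesh size `h = max_T h_T`. -/
def meshSize (K : Geometry.SimplicialComplex ℝ E3) : ℝ := sSup (maxEdge '' triangles K)

/-- A simplicial complex `K`, with underlying polyhedral surface `K.space`, is an admissible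
triangulation for `Γ` with quasi-uniformity constant `ϱ`. -/
structure IsAdmissible (Γ : ClosedC2Surface) (ϱ : ℝ) (K : Geometry.SimplicialComplex ℝ E3) :
    Prop where
  finite : K.faces.Finite
  /-- every vertex and edge belongs to a triangle, and there are no faces of higher dimension -/
  pure : ∀ s ∈ K.faces, ∃ t ∈ triangles K, (s : Set E3) ⊆ Set.range t.points
  quasiUniform : ∀ t ∈ triangles K, maxEdge t ≤ ϱ * t.inradius
  interpolation : ∀ t ∈ triangles K, ∀ i, t.points i ∈ Γ.carrier
  /-- `K.space` covers `Γ` exactly once: every point of `Γ` is lifted from exactly one point -/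
  simpleCover : ∀ p ∈ Γ.carrier, ∃! x, x ∈ K.space ∧ Γ.IsLift x p

/-- `νh` is a unit normal field of the polyhedral surface `K.space`; as usual, it is prescribed in
the (relative) interiors of the triangles only. -/
def IsDiscreteNormal (K : Geometry.SimplicialComplex ℝ E3) (νh : E3 → E3) : Prop :=
  ∀ t ∈ triangles K, ∀ x ∈ t.interior,
    ‖νh x‖ = 1 ∧ ∀ i j, ⟪νh x, t.points i - t.points j⟫ = 0

section Transformation

variable (Γ : ClosedC2Surface) (K : Geometry.SimplicialComplex ℝ E3)

/-- The surface measure `σ` of `Γ` transported to the polyhedral surface by the inverse of the lift: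
it assigns to `B` the area of the lift of `B ∩ K.space`. -/
def unliftedMeasure : Measure E3 :=
  (surfaceMeasure Γ.carrier).map (Function.invFunOn Γ.lift K.space)

/-- The surface measure quotient `μ_h = dσ / dσ_h`. -/
def measureQuotient (x : E3) : ℝ :=
  ((unliftedMeasure Γ K).rnDeriv (surfaceMeasure K.space) x).toReal

/-- `I - ν_h νᵀ / (ν_h · ν)`, with `ν` taken at the lifted point. -/
def obliqueProj (νh : E3 → E3) (x : E3) : E3 →L[ℝ] E3 :=
  1 - (⟪νh x, Γ.normal (Γ.lift x)⟫)⁻¹ • outerProd (νh x) (Γ.normal (Γ.lift x))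

/-- `(I - d 𝒜)⁻¹`. -/
def shapeInv (x : E3) : E3 →L[ℝ] E3 := Ring.inverse (1 - Γ.signedDist x • Γ.weingarten x)

/-- `R̃_h = μ_h P_h (I - ν_h νᵀ/(ν_h·ν))ᵀ (I - d𝒜)⁻¹ (I - d𝒜)⁻¹ (I - ν_h νᵀ/(ν_h·ν))`. -/
def RTilde (νh : E3 → E3) (x : E3) : E3 →L[ℝ] E3 :=
  measureQuotient Γ K x • (tangentialProj (νh x) ∘L (obliqueProj Γ νh x).adjoint ∘L
    shapeInv Γ x ∘L shapeInv Γ x ∘L obliqueProj Γ νh x)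

/-- `Ã_h = R̃_h P_h`, as a function on the polyhedral surface. -/
def ATilde (νh : E3 → E3) (x : E3) : E3 →L[ℝ] E3 := RTilde Γ K νh x ∘L tangentialProj (νh x)

end Transformation

end

/-! Near `Γ` the lift is the nearest-point map `a(x) = x - d(x)ν(x)`, whose derivative is the
symmetric map `P - d𝒜` with `P = I - ννᵀ`. As `𝒜` is symmetric and `𝒜ν = 0`, this equals `(I -
d𝒜)P`, and the chain rule gives `∇(φ ∘ a)(x) = (I - d𝒜) ∇_Γ φ (a(x))`. Hence on `Γ_h` the tangential
gradient of `v ∘ a` is `G = P_h (I - d𝒜) g`, with `g` the gradient of `v` at the lifted point. The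
vector `(I - d𝒜)g` is still orthogonal to `ν`, and on `ν^⊥` the oblique projection `I -
ν_hνᵀ/(ν_h·ν)` inverts `P_h`. Applying it and then `(I - d𝒜)⁻¹` recovers `g`, so `Ã_h G · G'` is
`μ_h g · g'` at the lifted point. Since `μ_h` is a Radon–Nikodym density, no Jacobian has to be
computed.

The rest justifies this computation. Normal coordinates show that `d` is `C²` near `Γ`
(`eventually_isTubular`), and compactness gives a uniform tube with bounded curvature. On a fine
shape-regular triangle with vertices on `Γ`, the normal `ν` is nearly orthogonal to the triangle
(`abs_inner_normal_le`). Therefore `ν_h·ν ≠ 0` and the lift is bi-Lipschitz on each triangle.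

Consequently the lift and its inverse distort area by at most a bounded factor
(`exists_measure_bounds`), so null sets and `L²` limits transfer between the surfaces and
approximating sequences can be pulled back (`hasTangentialGradient_comp_lift`). Finally, tangential
gradients on `Γ_h` are `L²` limits, and integration by parts on each triangle shows that they are
unique (`HasTangentialGradient.ae_eq`). An arbitrary gradient of `v ∘ a` is thus the explicit one
above. -/

/-! ### Regular level sets and normal coordinates -/

/-- The normalised gradient of a function. -/
noncomputable def unitGradient (φ : E3 → ℝ) (x : E3) : E3 := ‖∇ φ x‖⁻¹ • ∇ φ x

theorem gradient_ne_zero_iff {φ : E3 → ℝ} {x : E3} : ∇ φ x ≠ 0 ↔ fderiv ℝ φ x ≠ 0 := by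
  simp [gradient]

theorem inner_gradient {φ : E3 → ℝ} (x v : E3) : ⟪∇ φ x, v⟫ = fderiv ℝ φ x v := by
  simp [gradient]

theorem norm_unitGradient {φ : E3 → ℝ} {x : E3} (h : fderiv ℝ φ x ≠ 0) :
    ‖unitGradient φ x‖ = 1 := by
  have : ‖∇ φ x‖ ≠ 0 := norm_ne_zero_iff.2 (gradient_ne_zero_iff.2 h)
  simp [unitGradient, norm_smul, this]

theorem ContDiffAt.gradient {φ : E3 → ℝ} {x : E3} {n : WithTop ℕ∞} (h : ContDiffAt ℝ (n + 1) φ x) :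
    ContDiffAt ℝ n (∇ φ) x :=
  (InnerProductSpace.toDual ℝ E3).symm.toContinuousLinearEquiv.contDiff.contDiffAt.comp x
    (h.fderiv_right le_rfl)

theorem ContDiff.continuous_gradient {φ : E3 → ℝ} (h : ContDiff ℝ 1 φ) : Continuous (∇ φ) :=
  (InnerProductSpace.toDual ℝ E3).symm.continuous.comp (h.continuous_fderiv (by simp))

theorem ContDiffAt.unitGradient {φ : E3 → ℝ} {x : E3} (h : ContDiffAt ℝ 2 φ x)
    (h0 : fderiv ℝ φ x ≠ 0) : ContDiffAt ℝ 1 (unitGradient φ) x := by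
  have hg : ContDiffAt ℝ 1 (∇ φ) x :=
    ContDiffAt.gradient (n := 1) (by simpa [one_add_one_eq_two] using h)
  have h1 := gradient_ne_zero_iff.2 h0
  exact ((hg.norm ℝ h1).inv (norm_ne_zero_iff.2 h1)).smul hg

theorem fderiv_unitGradient_pos {φ : E3 → ℝ} {x : E3} (h : fderiv ℝ φ x ≠ 0) :
    0 < fderiv ℝ φ x (unitGradient φ x) := by
  have h1 := norm_pos_iff.2 (gradient_ne_zero_iff.2 h)
  rw [← inner_gradient, unitGradient, inner_smul_right, real_inner_self_eq_norm_sq]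
  positivity

theorem fderiv_apply_eq_inner_unitGradient {φ : E3 → ℝ} {x : E3} (h : fderiv ℝ φ x ≠ 0) (v : E3) :
    fderiv ℝ φ x v = ‖∇ φ x‖ * ⟪unitGradient φ x, v⟫ := by
  have h1 := norm_pos_iff.2 (gradient_ne_zero_iff.2 h)
  rw [unitGradient, inner_smul_left, inner_gradient]
  simp [h1.ne']

/-- Normal coordinates near a point of a regular level set. -/
theorem exists_normal_coordinates {φ : E3 → ℝ} {p₀ : E3} (h : ContDiffAt ℝ 2 φ p₀)
    (h0 : fderiv ℝ φ p₀ ≠ 0) (hp : φ p₀ = 0) :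
    ∃ H : E3 → E3 × ℝ, ContDiffAt ℝ 1 H p₀ ∧ H p₀ = (p₀, 0) ∧
      (∀ᶠ x in 𝓝 p₀, (H x).1 + (H x).2 • unitGradient φ (H x).1 = x ∧ φ (H x).1 = 0) ∧
      ∀ᶠ y : E3 × ℝ in 𝓝 (p₀, 0), φ y.1 = 0 → H (y.1 + y.2 • unitGradient φ y.1) = y := by
  set n := unitGradient φ with hn
  -- Adding `φ` as an extra component replaces a map on the level set by one between spaces of equal
  -- dimension, to which the inverse function theorem applies. Restricting the inverse to second
  -- component `0` forces the base point onto the level set.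
  set G : E3 × ℝ → E3 × ℝ := fun y => (y.1 + y.2 • n y.1, φ y.1) with hG
  have hn1 : ContDiffAt ℝ 1 n p₀ := h.unitGradient h0
  have hG1 : ContDiffAt ℝ 1 G (p₀, 0) := by
    refine ContDiffAt.prodMk ?_ ?_
    · refine contDiffAt_fst.add (contDiffAt_snd.smul ?_)
      exact ContDiffAt.comp (g := n) (f := Prod.fst) (p₀, (0 : ℝ)) hn1 contDiffAt_fst
    · exact ContDiffAt.comp (p₀, (0 : ℝ)) (h.of_le (by norm_num)) contDiffAt_fst
  let L : E3 × ℝ →L[ℝ] E3 × ℝ :=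
    (ContinuousLinearMap.fst ℝ E3 ℝ + (ContinuousLinearMap.snd ℝ E3 ℝ).smulRight (n p₀)).prod
      ((fderiv ℝ φ p₀).comp (ContinuousLinearMap.fst ℝ E3 ℝ))
  have hL : HasFDerivAt G L (p₀, 0) := by
    refine HasFDerivAt.prodMk ?_ ?_
    · have hn2 : HasFDerivAt (fun y : E3 × ℝ => n y.1)
          ((fderiv ℝ n p₀).comp (ContinuousLinearMap.fst ℝ E3 ℝ)) (p₀, 0) :=
        HasFDerivAt.comp (g := n) (f := Prod.fst) (p₀, (0 : ℝ))
          (hn1.differentiableAt (by simp)).hasFDerivAt hasFDerivAt_fst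
      have := (hasFDerivAt_fst (𝕜 := ℝ) (p := (p₀, (0 : ℝ)))).add
        ((hasFDerivAt_snd (𝕜 := ℝ) (p := (p₀, (0 : ℝ)))).smul hn2)
      refine this.congr_fderiv ?_
      ext y <;> simp
    · exact HasFDerivAt.comp (p₀, (0 : ℝ))
        (h.differentiableAt (by simp)).hasFDerivAt hasFDerivAt_fst
  -- The kernel equations are `v + s n = 0` and `dφ v = 0`; applying `dφ` to the first leaves `s
  -- dφ(n) = 0`, while `dφ(n) > 0`.
  have hinj : Function.Injective L := by
    rw [injective_iff_map_eq_zero]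
    rintro ⟨v, s⟩ hvs
    simp only [L, ContinuousLinearMap.prod_apply, Prod.mk_eq_zero] at hvs
    simp at hvs
    obtain ⟨h1, h2⟩ := hvs
    have h3 : fderiv ℝ φ p₀ (v + s • n p₀) = 0 := by rw [h1]; simp
    rw [map_add, h2, map_smul, zero_add, smul_eq_mul] at h3
    have h4 : s = 0 := by
      rcases mul_eq_zero.1 h3 with h | h
      · exact h
      · exact absurd h (fderiv_unitGradient_pos h0).ne'
    subst h4
    simpa using h1
  let Le : (E3 × ℝ) ≃L[ℝ] (E3 × ℝ) :=
    (LinearEquiv.ofInjectiveEndo (L : E3 × ℝ →ₗ[ℝ] E3 × ℝ) hinj).toContinuousLinearEquiv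
  have hLe : (Le : E3 × ℝ →L[ℝ] E3 × ℝ) = L := by ext <;> rfl
  have hG' : HasFDerivAt G (Le : E3 × ℝ →L[ℝ] E3 × ℝ) (p₀, 0) := by rw [hLe]; exact hL
  have hS : HasStrictFDerivAt G (Le : E3 × ℝ →L[ℝ] E3 × ℝ) (p₀, 0) :=
    hG1.hasStrictFDerivAt' hG' (by simp)
  have hG0 : G (p₀, 0) = (p₀, 0) := by simp [hG, hp]
  set I := HasStrictFDerivAt.localInverse G Le (p₀, 0) hS with hI
  have hIc : ContDiffAt ℝ 1 I (p₀, 0) := by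
    have := hG1.to_localInverse hG' (by simp)
    rwa [hG0] at this
  have hr := hS.eventually_right_inverse
  have hl := hS.eventually_left_inverse
  rw [hG0] at hr
  have hI0 : I (p₀, 0) = (p₀, 0) := by
    have := hl.self_of_nhds
    rwa [hG0] at this
  have hemb : Tendsto (fun x : E3 => (x, (0 : ℝ))) (𝓝 p₀) (𝓝 (p₀, 0)) :=
    (Continuous.prodMk continuous_id continuous_const).tendsto p₀
  refine ⟨fun x => I (x, 0), ?_, hI0, ?_, ?_⟩
  · exact ContDiffAt.comp p₀ (g := I) (f := fun x : E3 => (x, (0 : ℝ))) hIc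
      (contDiffAt_id.prodMk contDiffAt_const)
  · filter_upwards [hemb.eventually hr] with x hx
    have hx' : G (I (x, 0)) = (x, 0) := hx
    exact ⟨congrArg Prod.fst hx', congrArg Prod.snd hx'⟩
  · filter_upwards [hl] with y hy hy0
    have hy' : I (G y) = y := hy
    simpa [hG, hy0] using hy'

/-- The vector from a nearest point of a regular level set is normal to the level set. -/
theorem exists_eq_smul_unitGradient_of_isMinOn {φ : E3 → ℝ} {p x : E3} (h : ContDiffAt ℝ 1 φ p)
    (h0 : fderiv ℝ φ p ≠ 0)
    (hmin : IsLocalMinOn (fun q => dist x q) {q | φ q = φ p} p) :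
    ∃ t : ℝ, |t| = dist x p ∧ p + t • unitGradient φ p = x := by
  -- The squared distance is differentiable even when `x = p`, so Lagrange multipliers apply without
  -- a case distinction.
  have hmin2 : IsLocalMinOn (fun q => ‖q - x‖ ^ 2) {q | φ q = φ p} p := by
    filter_upwards [hmin] with q hq
    have hq' : dist x p ≤ dist x q := hq
    rw [dist_comm x p, dist_comm x q, dist_eq_norm, dist_eq_norm] at hq'
    gcongr
  have hd : HasStrictFDerivAt (fun q : E3 => ‖q - x‖ ^ 2) (2 • (innerSL ℝ (p - x))) p := by
    have := (hasStrictFDerivAt_norm_sq (p - x)).comp p ((hasStrictFDerivAt_id p).sub_const x)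
    simpa using! this
  obtain ⟨a, b, hab, he⟩ := IsLocalExtrOn.exists_multipliers_of_hasStrictFDerivAt_1d
    (Or.inl hmin2) (h.hasStrictFDerivAt (by simp)) hd
  have hb : b ≠ 0 := by
    rintro rfl
    have ha : a ≠ 0 := by rintro rfl; exact hab rfl
    simp [ha, h0] at he
  have key : x - p = (a / (2 * b)) • ∇ φ p := by
    refine ext_inner_right ℝ fun v => ?_
    have := congrArg (fun l : E3 →L[ℝ] ℝ => l v) he
    simp only [add_apply, smul_apply, innerSL_apply_apply,
      zero_apply, smul_eq_mul, nsmul_eq_mul] at this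
    rw [inner_smul_left, inner_gradient, ← neg_sub p x, inner_neg_left]
    simp only [conj_trivial]
    field_simp
    push_cast at this
    linarith
  have hg := norm_ne_zero_iff.2 (gradient_ne_zero_iff.2 h0)
  refine ⟨a / (2 * b) * ‖∇ φ p‖, ?_, ?_⟩
  · rw [dist_eq_norm, key, norm_smul, abs_mul, abs_norm, Real.norm_eq_abs]
  · rw [unitGradient, smul_smul, mul_assoc, mul_inv_cancel₀ hg, mul_one, ← key]
    abel

theorem tangentialProj_apply (n v : E3) : tangentialProj n v = v - ⟪n, v⟫ • n := by
  simp [tangentialProj, outerProd]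

theorem inner_tangentialProj (n u v : E3) : ⟪tangentialProj n u, v⟫ = ⟪u, tangentialProj n v⟫ := by
  simp only [tangentialProj_apply, inner_sub_left, inner_sub_right, inner_smul_left,
    inner_smul_right, conj_trivial, real_inner_comm n u]
  ring

/-! ### The signed distance near the surface -/

namespace ClosedC2Surface

variable (Γ : ClosedC2Surface)

/-- The point `x - d(x) ν(x)`, which near the surface is the nearest point of the surface. -/
noncomputable def foot (x : E3) : E3 := x - Γ.signedDist x • Γ.normal x

/-- The local properties of the signed distance near the surface. -/
structure IsTubular (x : E3) : Prop where
  contDiffAt : ContDiffAt ℝ 2 Γ.signedDist x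
  norm_normal : ‖Γ.normal x‖ = 1
  foot_mem : Γ.foot x ∈ Γ.carrier
  normal_foot : Γ.normal (Γ.foot x) = Γ.normal x
  eq_foot : ∀ p ∈ Γ.carrier, dist x p = Metric.infDist x Γ.carrier → p = Γ.foot x

theorem isClosed_carrier : IsClosed Γ.carrier := isClosed_frontier

theorem isCompact_carrier : IsCompact Γ.carrier :=
  Metric.isCompact_of_isClosed_isBounded Γ.isClosed_carrier
    (Γ.isBounded_inside.closure.subset frontier_subset_closure)

theorem abs_signedDist (x : E3) : |Γ.signedDist x| = Metric.infDist x Γ.carrier := by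
  unfold signedDist
  split_ifs <;> simp [abs_of_nonneg Metric.infDist_nonneg]

-- The open set `inside` omits its frontier, so `φ ≥ 0` there, and `φ > 0` would exclude `inside`
-- from a neighbourhood. Conversely, at a zero of `φ` the nonvanishing derivative makes `φ` negative
-- at points arbitrarily close by, reached by moving against the gradient.
variable {Γ} in
theorem mem_carrier_iff_of_defining {U : Set E3} {φ : E3 → ℝ} (hU : IsOpen U)
    (hφ : ContDiffOn ℝ 2 φ U) (hd : ∀ x ∈ U, fderiv ℝ φ x ≠ 0)
    (hin : Γ.inside ∩ U = {x ∈ U | φ x < 0}) {x : E3} (hx : x ∈ U) :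
    x ∈ Γ.carrier ↔ φ x = 0 := by
  have hmem : ∀ y ∈ U, (y ∈ Γ.inside ↔ φ y < 0) := fun y hy => by
    have : y ∈ Γ.inside ∩ U ↔ y ∈ {x ∈ U | φ x < 0} := by rw [hin]
    simpa [hy] using this
  have hc := (hφ.contDiffAt (hU.mem_nhds hx))
  have hcont := hc.continuousAt
  unfold carrier
  rw [Γ.isOpen_inside.frontier_eq]
  constructor
  · rintro ⟨h1, h2⟩
    rw [hmem x hx, not_lt] at h2
    refine le_antisymm ?_ h2
    by_contra! hpos
    have hev : ∀ᶠ y in 𝓝 x, y ∈ U ∧ 0 < φ y :=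
      (hU.eventually_mem hx).and (hcont.eventually (lt_mem_nhds hpos))
    obtain ⟨y, ⟨hyU, hy0⟩, hyin⟩ := mem_closure_iff_nhds.1 h1 _ hev
    exact absurd ((hmem y hyU).1 hyin) (not_lt.2 hy0.le)
  · intro h0
    refine ⟨?_, fun h => absurd ((hmem x hx).1 h) (by simp [h0])⟩
    rw [mem_closure_iff_nhds]
    intro V hV
    set n := unitGradient φ x
    have hline : HasDerivAt (fun s : ℝ => φ (x + s • n)) (fderiv ℝ φ x n) 0 := by
      have h1 : HasFDerivAt φ (fderiv ℝ φ x) (x + (0 : ℝ) • n) := by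
        simpa using (hc.differentiableAt (by simp)).hasFDerivAt
      have h2 : HasDerivAt (fun s : ℝ => x + s • n) n 0 := by
        simpa using ((hasDerivAt_id (0 : ℝ)).smul_const n).const_add x
      exact h1.comp_hasDerivAt 0 h2
    have hpos : 0 < fderiv ℝ φ x n := fderiv_unitGradient_pos (hd x hx)
    have hsl := (hasDerivAt_iff_tendsto_slope.1 hline).eventually (lt_mem_nhds hpos)
    have hT : Tendsto (fun s : ℝ => x + s • n) (𝓝 0) (𝓝 x) := by
      have : Continuous (fun s : ℝ => x + s • n) := by fun_prop
      simpa using this.tendsto 0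
    have hev1 := hT.eventually ((hU.eventually_mem hx).and (show ∀ᶠ y in 𝓝 x, y ∈ V from hV))
    have hle : 𝓝[<] (0 : ℝ) ≤ 𝓝[≠] 0 := nhdsWithin_mono 0 fun s hs => ne_of_lt hs
    obtain ⟨s, ⟨hs1, hs2, hs3⟩, hs4⟩ :=
      (((hsl.filter_mono hle).and (hev1.filter_mono nhdsWithin_le_nhds)).and
        self_mem_nhdsWithin).exists
    refine ⟨_, hs3, (hmem _ hs2).2 ?_⟩
    have hs4' : s < 0 := hs4
    rw [slope_def_field] at hs1
    simp only [zero_smul, add_zero, h0, sub_zero] at hs1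
    by_contra! hcon
    exact absurd hs1 (not_lt.2 (div_nonpos_of_nonneg_of_nonpos hcon hs4'.le))

/-- In the normal coordinates `H`, the first component is the unique nearest point and the second is
the signed distance. A nearest point is a constrained minimiser of the distance, so `x` lies on its
normal line, and `H` is inverse to the normal-line parametrisation. -/
theorem eventually_isTubular {p₀ : E3} (hp₀ : p₀ ∈ Γ.carrier) : ∀ᶠ x in 𝓝 p₀, Γ.IsTubular x := by
  obtain ⟨U, φ, hU, hpU, hφ, hd, hin⟩ := Γ.exists_defining p₀ hp₀
  have hcar : ∀ x ∈ U, (x ∈ Γ.carrier ↔ φ x = 0) := fun x hx =>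
    mem_carrier_iff_of_defining hU hφ hd hin hx
  have hinside : ∀ y ∈ U, (y ∈ Γ.inside ↔ φ y < 0) := fun y hy => by
    have : y ∈ Γ.inside ∩ U ↔ y ∈ {x ∈ U | φ x < 0} := by rw [hin]
    simpa [hy] using this
  have hC : ∀ x ∈ U, ContDiffAt ℝ 2 φ x := fun x hx => hφ.contDiffAt (hU.mem_nhds hx)
  set n := unitGradient φ with hn
  obtain ⟨H, hH, hH0, hr, hl⟩ := exists_normal_coordinates (hC p₀ hpU) (hd p₀ hpU)
    ((hcar p₀ hpU).1 hp₀)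
  -- a ball on which everything holds
  have hgpos : ∀ᶠ z : E3 × E3 in 𝓝 (p₀, p₀), 0 < fderiv ℝ φ z.1 (n z.2) := by
    have hcf : ContinuousAt (fderiv ℝ φ) p₀ :=
      ((hC p₀ hpU).fderiv_right (m := 1) (by norm_num)).continuousAt
    have hcn : ContinuousAt n p₀ := ((hC p₀ hpU).unitGradient (hd p₀ hpU)).continuousAt
    have h1 : ContinuousAt (fun z : E3 × E3 => fderiv ℝ φ z.1) (p₀, p₀) :=
      ContinuousAt.comp (f := Prod.fst) (g := fderiv ℝ φ) hcf continuousAt_fst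
    have h2 : ContinuousAt (fun z : E3 × E3 => n z.2) (p₀, p₀) :=
      ContinuousAt.comp (f := Prod.snd) (g := n) hcn continuousAt_snd
    exact (h1.clm_apply h2).eventually (lt_mem_nhds (fderiv_unitGradient_pos (hd p₀ hpU)))
  obtain ⟨ε, hε, hball⟩ : ∃ ε > 0, Metric.ball p₀ ε ⊆ U ∧
      (∀ y ∈ Metric.ball p₀ ε, ∀ z ∈ Metric.ball p₀ ε, 0 < fderiv ℝ φ y (n z)) ∧
      (∀ p ∈ Metric.ball p₀ ε, ∀ t : ℝ, |t| < ε → φ p = 0 → H (p + t • n p) = (p, t)) := by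
    obtain ⟨ε₁, h1, h1'⟩ := Metric.isOpen_iff.1 hU p₀ hpU
    obtain ⟨ε₂, h2, h2'⟩ := Metric.eventually_nhds_iff_ball.1 hgpos
    obtain ⟨ε₃, h3, h3'⟩ := Metric.eventually_nhds_iff_ball.1 hl
    refine ⟨min ε₁ (min ε₂ ε₃), by positivity, ?_, ?_, ?_⟩
    · exact (Metric.ball_subset_ball (min_le_left _ _)).trans h1'
    · intro y hy z hz
      refine h2' (y, z) ?_
      rw [Metric.mem_ball, Prod.dist_eq]
      simp only [Metric.mem_ball, lt_min_iff] at hy hz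
      exact max_lt hy.2.1 hz.2.1
    · intro p hp t ht h0
      refine h3' (p, t) ?_ h0
      rw [Metric.mem_ball, Prod.dist_eq]
      simp only [Metric.mem_ball, lt_min_iff] at hp ht
      refine max_lt hp.2.2 ?_
      rw [Real.dist_eq, sub_zero]
      exact ht.2.2
  obtain ⟨hbU, hbpos, hbH⟩ := hball
  -- nearest points are given by `H`
  have hnear : ∀ x ∈ Metric.ball p₀ (ε / 2), ∀ p ∈ Γ.carrier,
      dist x p = Metric.infDist x Γ.carrier → (H x).1 = p ∧ |(H x).2| = dist x p := by
    intro x hx p hp hxp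
    have h1 : dist x p ≤ dist x p₀ := hxp ▸ Metric.infDist_le_dist_of_mem hp₀
    rw [Metric.mem_ball] at hx
    -- The nearest point is at distance at most `2 * dist x p₀ < ε` from `p₀`; hence the radius `ε /
    -- 2`.
    have hpb : p ∈ Metric.ball p₀ ε := by
      rw [Metric.mem_ball]
      calc dist p p₀ ≤ dist p x + dist x p₀ := dist_triangle _ _ _
        _ < ε := by rw [dist_comm p x]; linarith
    have hpU' := hbU hpb
    obtain ⟨t, ht, htx⟩ := exists_eq_smul_unitGradient_of_isMinOn (x := x)
      ((hC p hpU').of_le (by norm_num)) (hd p hpU') (by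
        filter_upwards [self_mem_nhdsWithin, mem_nhdsWithin_of_mem_nhds (hU.mem_nhds hpU')]
          with q hq hqU
        have hq' : φ q = φ p := hq
        rw [(hcar p hpU').1 hp] at hq'
        change dist x p ≤ dist x q
        rw [hxp]
        exact Metric.infDist_le_dist_of_mem ((hcar q hqU).2 hq'))
    have := hbH p hpb t (by rw [ht]; linarith) ((hcar p hpU').1 hp)
    rw [← hn] at htx
    rw [htx] at this
    rw [this]
    exact ⟨rfl, ht⟩
  have hHc : ContinuousAt H p₀ := hH.continuousAt
  have hHb : ∀ᶠ x in 𝓝 p₀, (H x).1 ∈ Metric.ball p₀ ε := by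
    have h1 : ContinuousAt (fun x => (H x).1) p₀ := hHc.fst
    have h2 : (fun x => (H x).1) p₀ = p₀ := by simp [hH0]
    exact h1.eventually (by rw [h2]; exact Metric.ball_mem_nhds p₀ hε)
  -- the signed distance is the second component of `H`
  have hsd : ∀ᶠ x in 𝓝 p₀, Γ.signedDist x = (H x).2 := by
    filter_upwards [hHb, hr, Metric.ball_mem_nhds p₀ (half_pos hε)] with x hxb hxr hx
    have hx' : x ∈ Metric.ball p₀ ε := Metric.ball_subset_ball (by linarith) hx
    obtain ⟨p, hp, hpd⟩ := Γ.isCompact_carrier.exists_infDist_eq_dist ⟨p₀, hp₀⟩ x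
    have h2 := (hnear x hx p hp hpd.symm).2
    -- By the mean value theorem from the foot to `x`, `φ x` is the normal coordinate times a
    -- positive number. Its sign, which decides whether `x` is inside, is therefore that of the
    -- normal coordinate.
    obtain ⟨z, hz, hzφ⟩ := domain_mvt (f := φ) (f' := fderiv ℝ φ) (s := Metric.ball p₀ ε)
      (fun y hy => ((hC y (hbU hy)).differentiableAt (by simp)).hasFDerivAt.hasFDerivWithinAt)
      (convex_ball p₀ ε) hxb hx'
    have hz' : z ∈ Metric.ball p₀ ε := (convex_ball p₀ ε).segment_subset hxb hx' hz
    have hpos := hbpos z hz' _ hxb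
    have hxsub : x - (H x).1 = (H x).2 • n (H x).1 := by
      rw [sub_eq_iff_eq_add']; exact hxr.1.symm
    rw [hxsub, hxr.2, map_smul, sub_zero, smul_eq_mul] at hzφ
    have hin' := hinside x (hbU hx')
    unfold signedDist
    rw [hpd, ← h2]
    split_ifs with hi
    · rw [hin', hzφ] at hi
      rw [abs_of_neg (neg_of_mul_neg_left hi hpos.le), neg_neg]
    · rw [hin', hzφ, not_lt] at hi
      rw [abs_of_nonneg (nonneg_of_mul_nonneg_left hi hpos)]
  -- the gradient of the signed distance
  have hder : ∀ᶠ x in 𝓝 p₀, HasFDerivAt Γ.signedDist (innerSL ℝ (n (H x).1)) x := by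
    filter_upwards [hHb, hr.eventually_nhds, hsd.eventually_nhds, hHb.eventually_nhds,
      hH.eventually (by simp)] with x hxb hxr hxs hxb' hxH
    have hHd : HasFDerivAt H (fderiv ℝ H x) x := (hxH.differentiableAt (by simp)).hasFDerivAt
    set π' := (ContinuousLinearMap.fst ℝ E3 ℝ).comp (fderiv ℝ H x) with hπ'
    set τ' := (ContinuousLinearMap.snd ℝ E3 ℝ).comp (fderiv ℝ H x) with hτ'
    have hπ : HasFDerivAt (fun y => (H y).1) π' x := hHd.fst
    have hτ : HasFDerivAt (fun y => (H y).2) τ' x := hHd.snd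
    have hU1 := hbU hxb
    have hnd : HasFDerivAt (fun y => n (H y).1) ((fderiv ℝ n (H x).1).comp π') x :=
      HasFDerivAt.comp (g := n) (f := fun y => (H y).1) x
        (((hC _ hU1).unitGradient (hd _ hU1)).differentiableAt (by simp)).hasFDerivAt hπ
    set m' := (fderiv ℝ n (H x).1).comp π'
    -- Write `π`, `τ` for the components of `H`. Differentiate `π + τ n(π) = id`, `φ(π) = 0` and
    -- `|n(π)|² = 1`. The last two make `dπ` and `d(n ∘ π)` orthogonal to `n`, so pairing the first
    -- with `n` leaves `dτ = ⟨n, ·⟩`.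
    have e1 : π' + ((H x).2 • m' + τ'.smulRight (n (H x).1)) = ContinuousLinearMap.id ℝ E3 := by
      refine (hπ.add (hτ.smul hnd)).unique ((hasFDerivAt_id x).congr_of_eventuallyEq ?_)
      filter_upwards [hxr] with y hy using hy.1
    have e2 : ∀ v, fderiv ℝ φ (H x).1 (π' v) = 0 := by
      have h1 := ((hC _ hU1).differentiableAt (by simp)).hasFDerivAt.comp x hπ
      have h2 : (fderiv ℝ φ (H x).1).comp π' = 0 := by
        refine h1.unique ((hasFDerivAt_const (0 : ℝ) x).congr_of_eventuallyEq ?_)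
        filter_upwards [hxr] with y hy using hy.2
      exact fun v => congrArg (fun l : E3 →L[ℝ] ℝ => l v) h2
    have e3 : ∀ v, ⟪n (H x).1, m' v⟫ = 0 := by
      have h1 := hnd.inner ℝ hnd
      have h2 := h1.unique ((hasFDerivAt_const (1 : ℝ) x).congr_of_eventuallyEq (by
        filter_upwards [hxb'] with y hy
        rw [real_inner_self_eq_norm_sq, norm_unitGradient (hd _ (hbU hy)), one_pow]))
      intro v
      have h3 := congrArg (fun l : E3 →L[ℝ] ℝ => l v) h2
      simp [fderivInnerCLM_apply] at h3
      rw [real_inner_comm] at h3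
      rw [real_inner_comm]
      linarith
    refine (hτ.congr_of_eventuallyEq hxs).congr_fderiv ?_
    ext v
    have e4 := congrArg (fun l : E3 →L[ℝ] E3 => ⟪n (H x).1, l v⟫) e1
    have e5 := e2 v
    rw [fderiv_apply_eq_inner_unitGradient (hd _ hU1)] at e5
    have e6 : ⟪n (H x).1, π' v⟫ = 0 := by
      rcases mul_eq_zero.1 e5 with h | h
      · exact absurd h (norm_ne_zero_iff.2 (gradient_ne_zero_iff.2 (hd _ hU1)))
      · exact h
    have e7 : ⟪n (H x).1, n (H x).1⟫ = 1 := by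
      rw [real_inner_self_eq_norm_sq, norm_unitGradient (hd _ hU1), one_pow]
    simp only [add_apply, smul_apply, ContinuousLinearMap.smulRight_apply, inner_add_right,
      inner_smul_right, e6, e3, e7, ContinuousLinearMap.id_apply] at e4
    simp only [innerSL_apply_apply]
    linarith
  have hnor : ∀ᶠ x in 𝓝 p₀, Γ.normal x = n (H x).1 := by
    filter_upwards [hder] with x hx
    refine ext_inner_right ℝ fun v => ?_
    rw [normal, inner_gradient, hx.fderiv, innerSL_apply_apply]
  have hHp : ∀ x ∈ Metric.ball p₀ ε, φ x = 0 → (H x).1 = x := fun x hx h0 => by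
    have := hbH x hx 0 (by simpa using hε) h0
    rw [zero_smul, add_zero] at this
    rw [this]
  have hπt : Tendsto (fun x => (H x).1) (𝓝 p₀) (𝓝 p₀) := by
    have h1 : ContinuousAt (fun x => (H x).1) p₀ := hHc.fst
    have h2 : (fun x => (H x).1) p₀ = p₀ := by simp [hH0]
    simpa only [ContinuousAt, h2] using h1
  filter_upwards [hHb, hr, hsd, hder.eventually_nhds, hnor, hπt.eventually hnor,
    hH.eventually (by simp), Metric.ball_mem_nhds p₀ (half_pos hε)] with
    x hxb hxr hxs hxd hxn hxn' hxH hx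
  have hU1 := hbU hxb
  have hfoot : Γ.foot x = (H x).1 := by
    rw [foot, hxs, hxn, sub_eq_iff_eq_add]; exact hxr.1.symm
  refine ⟨?_, ?_, ?_, ?_, ?_⟩
  -- `H` is only `C¹`, but the gradient of `d` is `n ∘ π`, which is itself `C¹`; this gains one
  -- derivative for `d`.
  · have : (2 : WithTop ℕ∞) = ((1 : ℕ) : WithTop ℕ∞) + 1 := by norm_num
    rw [this, contDiffAt_succ_iff_hasFDerivAt]
    refine ⟨fun y => innerSL ℝ (n (H y).1), ⟨_, hxd, fun y hy => hy⟩, ?_⟩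
    exact (innerSL ℝ (E := E3)).contDiff.contDiffAt.comp x
      (ContDiffAt.comp (g := n) (f := fun y => (H y).1) x
        ((hC _ hU1).unitGradient (hd _ hU1)) hxH.fst)
  · rw [hxn, norm_unitGradient (hd _ hU1)]
  · rw [hfoot, hcar _ hU1]; exact hxr.2
  · rw [hfoot, hxn', hxn, hHp _ hxb hxr.2]
  · intro p hp hxp
    rw [hfoot]
    exact (hnear x hx p hp hxp).1.symm

end ClosedC2Surface

/-! ### Calculus in a tubular neighbourhood -/

namespace ClosedC2Surface

variable {Γ : ClosedC2Surface}

theorem IsTubular.hasFDerivAt_signedDist {x : E3} (h : Γ.IsTubular x) :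
    HasFDerivAt Γ.signedDist (innerSL ℝ (Γ.normal x)) x := by
  have h1 := (h.contDiffAt.differentiableAt (by simp)).hasFDerivAt
  refine h1.congr_fderiv ?_
  ext v
  rw [innerSL_apply_apply, normal, inner_gradient]

theorem IsTubular.contDiffAt_normal {x : E3} (h : Γ.IsTubular x) :
    ContDiffAt ℝ 1 Γ.normal x :=
  ContDiffAt.gradient (n := 1) (by simpa [one_add_one_eq_two] using h.contDiffAt)

theorem IsTubular.hasFDerivAt_normal {x : E3} (h : Γ.IsTubular x) :
    HasFDerivAt Γ.normal (Γ.weingarten x) x :=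
  (h.contDiffAt_normal.differentiableAt (by simp)).hasFDerivAt

theorem IsTubular.continuousAt_weingarten {x : E3} (h : Γ.IsTubular x) :
    ContinuousAt Γ.weingarten x :=
  (h.contDiffAt_normal.fderiv_right (m := 0) (by norm_num)).continuousAt

theorem IsTubular.contDiffAt_foot {x : E3} (h : Γ.IsTubular x) : ContDiffAt ℝ 1 Γ.foot x :=
  contDiffAt_id.sub ((h.contDiffAt.of_le (by norm_num)).smul h.contDiffAt_normal)

theorem IsTubular.inner_weingarten {x : E3} (h : Γ.IsTubular x) (u v : E3) :
    ⟪Γ.weingarten x u, v⟫ = ⟪u, Γ.weingarten x v⟫ := by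
  have hs : IsSymmSndFDerivAt ℝ Γ.signedDist x := h.contDiffAt.isSymmSndFDerivAt (by simp)
  have key : ∀ a b, ⟪Γ.weingarten x a, b⟫ = fderiv ℝ (fderiv ℝ Γ.signedDist) x a b := by
    intro a b
    have h1 : HasFDerivAt (fderiv ℝ Γ.signedDist) (fderiv ℝ (fderiv ℝ Γ.signedDist) x) x :=
      ((h.contDiffAt.fderiv_right (m := 1) (by norm_num)).differentiableAt (by simp)).hasFDerivAt
    have h2 := (innerSL ℝ b).hasFDerivAt.comp x h.hasFDerivAt_normal
    have h3 := (ContinuousLinearMap.apply ℝ ℝ b).hasFDerivAt.comp x h1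
    have h4 : (fun y => innerSL ℝ b (Γ.normal y)) =
        fun y => ContinuousLinearMap.apply ℝ ℝ b (fderiv ℝ Γ.signedDist y) := by
      ext y
      rw [innerSL_apply_apply, real_inner_comm, normal, inner_gradient,
        ContinuousLinearMap.apply_apply]
    have h5 := congrArg (fun l : E3 →L[ℝ] ℝ => l a) (h2.unique (h3.congr_of_eventuallyEq
      (Eventually.of_forall (congrFun h4))))
    simpa [real_inner_comm] using h5
  rw [key, hs.eq, ← key, real_inner_comm]

/-- Differentiating `|ν|² = 1` shows that the range of `𝒜` is orthogonal to `ν`; symmetry then puts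
`ν` in the kernel. -/
theorem IsTubular.weingarten_normal {x : E3} (h : Γ.IsTubular x)
    (hn : ∀ᶠ y in 𝓝 x, Γ.IsTubular y) : Γ.weingarten x (Γ.normal x) = 0 := by
  refine ext_inner_right ℝ fun v => ?_
  rw [h.inner_weingarten, inner_zero_left]
  have h1 := h.hasFDerivAt_normal.inner ℝ h.hasFDerivAt_normal
  have h2 := h1.unique ((hasFDerivAt_const (1 : ℝ) x).congr_of_eventuallyEq (by
    filter_upwards [hn] with y hy
    rw [real_inner_self_eq_norm_sq, hy.norm_normal, one_pow]))
  have h3 := congrArg (fun l : E3 →L[ℝ] ℝ => l v) h2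
  simp [fderivInnerCLM_apply] at h3
  rw [real_inner_comm] at h3
  rw [real_inner_comm]
  linarith

theorem IsTubular.hasFDerivAt_foot {x : E3} (h : Γ.IsTubular x) :
    HasFDerivAt Γ.foot (tangentialProj (Γ.normal x) - Γ.signedDist x • Γ.weingarten x) x := by
  have h1 := (hasFDerivAt_id x).sub (h.hasFDerivAt_signedDist.smul h.hasFDerivAt_normal)
  refine h1.congr_fderiv ?_
  ext1 v
  simp only [tangentialProj, outerProd, sub_apply, add_apply, smul_apply, one_apply_eq_self,
    InnerProductSpace.rankOne_apply, ContinuousLinearMap.smulRight_apply, innerSL_apply_apply,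
    ContinuousLinearMap.id_apply]
  abel

/-- The gradient is the adjoint derivative of the foot map applied to `∇φ`. That derivative `P - d𝒜`
is symmetric and, because `𝒜ν = 0`, factors as `(I - d𝒜)P`. -/
theorem IsTubular.gradient_comp_foot {x : E3} (h : Γ.IsTubular x)
    (hn : ∀ᶠ y in 𝓝 x, Γ.IsTubular y) {φ : E3 → ℝ} (hφ : Differentiable ℝ φ) :
    ∇ (φ ∘ Γ.foot) x = (1 - Γ.signedDist x • Γ.weingarten x)
      (tangentialProj (Γ.normal x) (∇ φ (Γ.foot x))) := by
  refine ext_inner_right ℝ fun v => ?_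
  have h1 := (hφ (Γ.foot x)).hasFDerivAt.comp x h.hasFDerivAt_foot
  rw [inner_gradient, h1.fderiv, ContinuousLinearMap.comp_apply, ← inner_gradient]
  have hν : tangentialProj (Γ.normal x) (Γ.weingarten x v) = Γ.weingarten x v := by
    rw [tangentialProj_apply, ← h.inner_weingarten, h.weingarten_normal hn, inner_zero_left,
      zero_smul, sub_zero]
  simp only [sub_apply, smul_apply, one_apply_eq_self, inner_sub_left, inner_sub_right,
    inner_smul_left, inner_smul_right, conj_trivial, h.inner_weingarten, inner_tangentialProj, hν]

variable (Γ) in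
/-- `δ` is the width of a tubular neighbourhood in which the curvature is bounded by `M`. -/
structure IsTube (δ M : ℝ) : Prop where
  pos : 0 < δ
  tubular : ∀ x ∈ Metric.thickening δ Γ.carrier, Γ.IsTubular x
  norm_weingarten_le : ∀ x ∈ Metric.thickening δ Γ.carrier, ‖Γ.weingarten x‖ ≤ M

variable (Γ) in
theorem exists_isTube : ∃ δ M : ℝ, Γ.IsTube δ M := by
  set W : Set E3 := {x | ∀ᶠ y in 𝓝 x, Γ.IsTubular y} with hW
  have hWo : IsOpen W := isOpen_setOfPred_eventually_nhds
  obtain ⟨δ, hδ, hsub⟩ := Γ.isCompact_carrier.exists_cthickening_subset_open hWo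
    fun p hp => Γ.eventually_isTubular hp
  have hc : IsCompact (Metric.cthickening δ Γ.carrier) := Γ.isCompact_carrier.cthickening
  obtain ⟨M, hM⟩ := hc.exists_bound_of_continuousOn (f := Γ.weingarten) fun x hx =>
    (hsub hx).self_of_nhds.continuousAt_weingarten.continuousWithinAt
  exact ⟨δ, M, hδ, fun x hx => (hsub (Metric.thickening_subset_cthickening _ _ hx)).self_of_nhds,
    fun x hx => hM x (Metric.thickening_subset_cthickening _ _ hx)⟩

namespace IsTube

variable {δ M : ℝ} {x : E3}

theorem eventually (h : Γ.IsTube δ M) (hx : x ∈ Metric.thickening δ Γ.carrier) :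
    ∀ᶠ y in 𝓝 x, Γ.IsTubular y := by
  filter_upwards [Metric.isOpen_thickening.mem_nhds hx] with y hy using h.tubular y hy

theorem isTubular_of_mem (h : Γ.IsTube δ M) (hx : x ∈ Γ.carrier) : Γ.IsTubular x :=
  h.tubular x (Metric.self_subset_thickening h.pos _ hx)

/-- A lift lies at distance `|d(x)|` from `x`, so it is a nearest point, and nearest points in the
tube are unique. Conversely, the foot is a lift because `ν` takes the same value at `x` and at its
foot. -/
theorem isLift_iff (h : Γ.IsTube δ M) (hx : x ∈ Metric.thickening δ Γ.carrier) {p : E3} :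
    Γ.IsLift x p ↔ p = Γ.foot x := by
  have hT := h.tubular x hx
  constructor
  · rintro ⟨hp, he⟩
    refine hT.eq_foot p hp ?_
    rw [dist_eq_norm]
    have : x - p = Γ.signedDist x • Γ.normal p := by
      rw [sub_eq_iff_eq_add, ← sub_eq_iff_eq_add']; exact he.symm
    rw [this, norm_smul, (h.isTubular_of_mem hp).norm_normal, mul_one, Real.norm_eq_abs,
      abs_signedDist]
  · rintro rfl
    exact ⟨hT.foot_mem, by rw [hT.normal_foot]; rfl⟩

theorem existsUnique_isLift (h : Γ.IsTube δ M) (hx : x ∈ Metric.thickening δ Γ.carrier) :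
    ∃! p, Γ.IsLift x p :=
  ⟨Γ.foot x, (h.isLift_iff hx).2 rfl, fun _ hp => (h.isLift_iff hx).1 hp⟩

theorem lift_eq_foot (h : Γ.IsTube δ M) (hx : x ∈ Metric.thickening δ Γ.carrier) :
    Γ.lift x = Γ.foot x :=
  (h.isLift_iff hx).1 (Classical.epsilon_spec ⟨_, (h.isLift_iff hx).2 rfl⟩)

theorem abs_signedDist_lt (hx : x ∈ Metric.thickening δ Γ.carrier) :
    |Γ.signedDist x| < δ := by
  rw [abs_signedDist]
  obtain ⟨p, hp, hd⟩ := Metric.mem_thickening_iff.1 hx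
  exact (Metric.infDist_le_dist_of_mem hp).trans_lt hd

theorem isUnit (h : Γ.IsTube δ M) (hδM : δ * M < 1) (hx : x ∈ Metric.thickening δ Γ.carrier) :
    IsUnit (1 - Γ.signedDist x • Γ.weingarten x) := by
  refine isUnit_one_sub_of_norm_lt_one ?_
  rw [norm_smul, Real.norm_eq_abs]
  refine lt_of_le_of_lt ?_ hδM
  exact mul_le_mul (abs_signedDist_lt hx).le (h.norm_weingarten_le x hx) (norm_nonneg _) h.pos.le

theorem norm_normal_sub_le (h : Γ.IsTube δ M) {s : Set E3} (hs : Convex ℝ s)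
    (hsub : s ⊆ Metric.thickening δ Γ.carrier) {y : E3} (hx : x ∈ s) (hy : y ∈ s) :
    ‖Γ.normal y - Γ.normal x‖ ≤ M * ‖y - x‖ :=
  hs.norm_image_sub_le_of_norm_hasFDerivWithin_le
    (fun z hz => (h.tubular z (hsub hz)).hasFDerivAt_normal.hasFDerivWithinAt)
    (fun z hz => h.norm_weingarten_le z (hsub hz)) hx hy

end IsTube

end ClosedC2Surface

/-- Shrinking the tube keeps the curvature bound, so `‖d𝒜‖ < 1` can be arranged and `I - d𝒜` is
inverted by a Neumann series. -/
theorem ClosedC2Surface.exists_isTube_mul_lt_one (Γ : ClosedC2Surface) :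
    ∃ δ M : ℝ, Γ.IsTube δ M ∧ 0 ≤ M ∧ δ * M < 1 := by
  obtain ⟨δ, M, h⟩ := Γ.exists_isTube
  have hM : (0 : ℝ) < |M| + 1 := by positivity
  refine ⟨min δ (1 / (|M| + 1)), |M|, ⟨lt_min h.pos (by positivity), ?_, ?_⟩, abs_nonneg M, ?_⟩
  · exact fun x hx => h.tubular x (Metric.thickening_mono (min_le_left _ _) _ hx)
  · exact fun x hx => (h.norm_weingarten_le x
      (Metric.thickening_mono (min_le_left _ _) _ hx)).trans (le_abs_self M)
  · calc min δ (1 / (|M| + 1)) * |M| ≤ 1 / (|M| + 1) * |M| := by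
          gcongr; exact min_le_right _ _
      _ < 1 := by rw [one_div, inv_mul_lt_one₀ hM]; linarith

/-! ### Small shape-regular triangles with vertices on the surface -/

/-- The reciprocal of the inradius is the sum of the reciprocals of the heights. -/
theorem Affine.Triangle.inradius_le_height (t : Affine.Triangle ℝ E3) (i : Fin 3) :
    t.inradius ≤ t.height i := by
  rw [Affine.Simplex.inradius_eq_abs_inv_sum, abs_of_pos (inv_pos.2
    t.sum_excenterWeightsUnnorm_empty_pos)]
  have hi := t.height_pos i
  rw [inv_le_comm₀ t.sum_excenterWeightsUnnorm_empty_pos hi]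
  simp only [Affine.Simplex.excenterWeightsUnnorm_empty_apply]
  exact Finset.single_le_sum (f := fun i => (t.height i)⁻¹)
    (fun j _ => (inv_pos.2 (t.height_pos j)).le) (Finset.mem_univ i)

/-- A linear functional that is small on the edges of a triangle is small on its plane. -/
theorem Affine.Triangle.abs_inner_mul_inradius_le (t : Affine.Triangle ℝ E3) {ν : E3} {B : ℝ}
    (hB : ∀ i j, |⟪ν, t.points i - t.points j⟫| ≤ B) {z : E3}
    (hz : z ∈ vectorSpan ℝ (Set.range t.points)) :
    |⟪ν, z⟫| * t.inradius ≤ 2 * B * ‖z‖ := by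
  rw [vectorSpan_range_eq_span_range_vsub_right ℝ t.points 0,
    Submodule.mem_span_range_iff_exists_fun] at hz
  obtain ⟨c, rfl⟩ := hz
  have hsum : ∑ i, c i • (t.points i -ᵥ t.points 0) =
      c 1 • (t.points 1 - t.points 0) + c 2 • (t.points 2 - t.points 0) :=
    (Fin.sum_univ_three fun i => c i • (t.points i - t.points 0)).trans (by simp)
  rw [hsum]
  set z := c 1 • (t.points 1 - t.points 0) + c 2 • (t.points 2 - t.points 0) with hz
  have hn : ∀ i, ‖t.points i - t.altitudeFoot i‖ = t.height i := fun i => by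
    rw [Affine.Simplex.height, dist_eq_norm]
  have h10 := t.inner_vsub_vsub_altitudeFoot_eq_height_sq (i := 1) (j := 0) (by decide)
  have h12 := t.inner_vsub_vsub_altitudeFoot_eq_height_sq (i := 1) (j := 2) (by decide)
  have h20 := t.inner_vsub_vsub_altitudeFoot_eq_height_sq (i := 2) (j := 0) (by decide)
  have h21 := t.inner_vsub_vsub_altitudeFoot_eq_height_sq (i := 2) (j := 1) (by decide)
  simp only [vsub_eq_sub] at h10 h12 h20 h21
  -- An altitude is orthogonal to the opposite edge, so pairing with it isolates one coefficient of
  -- `z`. Cauchy–Schwarz then gives `|c i| * height i ≤ ‖z‖`.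
  have e1 : ⟪z, t.points 1 - t.altitudeFoot 1⟫ = c 1 * t.height 1 ^ 2 := by
    have h3 : ⟪t.points 2 - t.points 0, t.points 1 - t.altitudeFoot 1⟫ = 0 := by
      rw [← sub_sub_sub_cancel_left (t.points 0) (t.points 2) (t.points 1), inner_sub_left, h10,
        h12, sub_self]
    rw [hz, inner_add_left, inner_smul_left, inner_smul_left, h10, h3]
    simp
  have e2 : ⟪z, t.points 2 - t.altitudeFoot 2⟫ = c 2 * t.height 2 ^ 2 := by
    have h3 : ⟪t.points 1 - t.points 0, t.points 2 - t.altitudeFoot 2⟫ = 0 := by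
      rw [← sub_sub_sub_cancel_left (t.points 0) (t.points 1) (t.points 2), inner_sub_left, h20,
        h21, sub_self]
    rw [hz, inner_add_left, inner_smul_left, inner_smul_left, h20, h3]
    simp
  have key : ∀ i : Fin 3, ⟪z, t.points i - t.altitudeFoot i⟫ = c i * t.height i ^ 2 →
      |c i| * t.inradius ≤ ‖z‖ := by
    intro i hi
    have h0 := t.height_pos i
    have h1 := abs_real_inner_le_norm z (t.points i - t.altitudeFoot i)
    rw [hi, hn, abs_mul, abs_of_pos (by positivity : 0 < t.height i ^ 2), pow_two, ← mul_assoc] at h1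
    exact (mul_le_mul_of_nonneg_left (t.inradius_le_height i) (abs_nonneg _)).trans
      (le_of_mul_le_mul_right h1 h0)
  have hB0 : 0 ≤ B := (abs_nonneg _).trans (hB 0 0)
  have hr := t.inradius_pos
  have k1 := key 1 e1
  have k2 := key 2 e2
  calc |⟪ν, z⟫| * t.inradius
      ≤ (|c 1| * B + |c 2| * B) * t.inradius := by
        gcongr
        rw [hz, inner_add_right, inner_smul_right, inner_smul_right]
        refine (abs_add_le _ _).trans ?_
        rw [abs_mul, abs_mul]
        gcongr
        · exact hB 1 0
        · exact hB 2 0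
    _ = B * (|c 1| * t.inradius) + B * (|c 2| * t.inradius) := by ring
    _ ≤ B * ‖z‖ + B * ‖z‖ := by gcongr
    _ = _ := by ring

theorem Affine.Triangle.sub_mem_vectorSpan (t : Affine.Triangle ℝ E3) {x y : E3}
    (hx : x ∈ convexHull ℝ (Set.range t.points)) (hy : y ∈ convexHull ℝ (Set.range t.points)) :
    x - y ∈ vectorSpan ℝ (Set.range t.points) :=
  vsub_mem_vectorSpan_of_mem_affineSpan_of_mem_affineSpan
    (convexHull_subset_affineSpan _ hx) (convexHull_subset_affineSpan _ hy)

theorem Affine.Triangle.vectorSpan_eq_orthogonal (t : Affine.Triangle ℝ E3) {n : E3} (hn : n ≠ 0)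
    (h : ∀ i j, ⟪n, t.points i - t.points j⟫ = 0) :
    vectorSpan ℝ (Set.range t.points) = (ℝ ∙ n)ᗮ := by
  refine Submodule.eq_of_le_of_finrank_eq ?_ ?_
  · rw [vectorSpan_range_eq_span_range_vsub_right ℝ t.points 0, Submodule.span_le]
    rintro _ ⟨i, rfl⟩
    rw [SetLike.mem_coe, Submodule.mem_orthogonal_singleton_iff_inner_right]
    exact h i 0
  · rw [t.independent.finrank_vectorSpan (Fintype.card_fin 3)]
    have : Fact (Module.finrank ℝ E3 = 2 + 1) := ⟨by simp⟩
    exact (Submodule.finrank_orthogonal_span_singleton hn).symm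

theorem maxEdge_nonneg (t : Affine.Triangle ℝ E3) : 0 ≤ maxEdge t := Metric.diam_nonneg

theorem dist_le_maxEdge (t : Affine.Triangle ℝ E3) {x y : E3}
    (hx : x ∈ convexHull ℝ (Set.range t.points)) (hy : y ∈ convexHull ℝ (Set.range t.points)) :
    dist x y ≤ maxEdge t := by
  rw [maxEdge, ← convexHull_diam]
  exact Metric.dist_le_diam_of_mem
    ((Set.finite_range t.points).isCompact_convexHull (𝕜 := ℝ)).isBounded hx hy

namespace ClosedC2Surface.IsTube

variable {Γ : ClosedC2Surface} {δ M ϱ : ℝ} {t : Affine.Triangle ℝ E3}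

theorem convexHull_subset (hδ : maxEdge t < δ)
    (hv : ∀ i, t.points i ∈ Γ.carrier) :
    convexHull ℝ (Set.range t.points) ⊆ Metric.thickening δ Γ.carrier := fun _ hx =>
  Metric.mem_thickening_iff.2 ⟨t.points 0, hv 0,
    (dist_le_maxEdge t hx (subset_convexHull ℝ _ ⟨0, rfl⟩)).trans_lt hδ⟩

theorem signedDist_eq_zero {p : E3} (hp : p ∈ Γ.carrier) : Γ.signedDist p = 0 := by
  rw [← abs_eq_zero, abs_signedDist, Metric.infDist_zero_of_mem hp]

theorem abs_signedDist_le_maxEdge (hv : ∀ i, t.points i ∈ Γ.carrier)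
    {x : E3} (hx : x ∈ convexHull ℝ (Set.range t.points)) : |Γ.signedDist x| ≤ maxEdge t := by
  rw [abs_signedDist]
  exact (Metric.infDist_le_dist_of_mem (hv 0)).trans
    (dist_le_maxEdge t hx (subset_convexHull ℝ _ ⟨0, rfl⟩))

theorem exists_signedDist_sub (h : Γ.IsTube δ M) (hδ : maxEdge t < δ)
    (hv : ∀ i, t.points i ∈ Γ.carrier) {x y : E3} (hx : x ∈ convexHull ℝ (Set.range t.points))
    (hy : y ∈ convexHull ℝ (Set.range t.points)) :
    ∃ z ∈ convexHull ℝ (Set.range t.points),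
      Γ.signedDist x - Γ.signedDist y = ⟪Γ.normal z, x - y⟫ := by
  have hc := convex_convexHull ℝ (Set.range t.points)
  obtain ⟨z, hz, he⟩ := domain_mvt (f := Γ.signedDist) (f' := fun z => innerSL ℝ (Γ.normal z))
    (fun z hz => (h.tubular z
      (convexHull_subset hδ hv hz)).hasFDerivAt_signedDist.hasFDerivWithinAt) hc hy hx
  exact ⟨z, hc.segment_subset hy hx hz, he⟩

/-- The normal of the surface is nearly orthogonal to a small shape regular triangle with
vertices on the surface. -/
theorem abs_inner_normal_le (h : Γ.IsTube δ M) (hM : 0 ≤ M) (hδ : maxEdge t < δ)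
    (hv : ∀ i, t.points i ∈ Γ.carrier) (hq : maxEdge t ≤ ϱ * t.inradius)
    {x z : E3} (hx : x ∈ convexHull ℝ (Set.range t.points))
    (hz : z ∈ vectorSpan ℝ (Set.range t.points)) :
    |⟪Γ.normal x, z⟫| ≤ 2 * M * ϱ * maxEdge t * ‖z‖ := by
  have h0 := maxEdge_nonneg t
  have hp : ∀ i, t.points i ∈ convexHull ℝ (Set.range t.points) :=
    fun i => subset_convexHull ℝ _ ⟨i, rfl⟩
  -- `d` vanishes at both ends of an edge, so by the mean value theorem `ν` is exactly orthogonal to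
  -- the edge at some point. Moving from there to `x` changes `ν` by at most `M * maxEdge t`. One of
  -- the two resulting factors of the edge length is later traded for the inradius.
  have hB : ∀ i j, |⟪Γ.normal x, t.points i - t.points j⟫| ≤ M * maxEdge t * maxEdge t := by
    intro i j
    obtain ⟨y, hy, he⟩ := h.exists_signedDist_sub hδ hv (hp i) (hp j)
    rw [signedDist_eq_zero (hv i), signedDist_eq_zero (hv j), sub_zero] at he
    have h1 : ⟪Γ.normal x, t.points i - t.points j⟫ =
        ⟪Γ.normal x - Γ.normal y, t.points i - t.points j⟫ := by
      rw [inner_sub_left, ← he, sub_zero]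
    rw [h1]
    refine (abs_real_inner_le_norm _ _).trans ?_
    refine mul_le_mul ?_ ?_ (norm_nonneg _) (by positivity)
    · refine (h.norm_normal_sub_le (convex_convexHull ℝ _) (convexHull_subset hδ hv)
        hy hx).trans ?_
      rw [← dist_eq_norm]
      exact mul_le_mul_of_nonneg_left (dist_le_maxEdge t hx hy) hM
    · rw [← dist_eq_norm]; exact dist_le_maxEdge t (hp i) (hp j)
  have h1 := t.abs_inner_mul_inradius_le hB hz
  refine le_of_mul_le_mul_right (h1.trans ?_) t.inradius_pos
  calc 2 * (M * maxEdge t * maxEdge t) * ‖z‖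
      ≤ 2 * (M * maxEdge t * (ϱ * t.inradius)) * ‖z‖ := by gcongr
    _ = _ := by ring

/-- On a small shape regular triangle the lift is close to the identity. -/
theorem norm_foot_sub_le (h : Γ.IsTube δ M) (hM : 0 ≤ M) (hδ : maxEdge t < δ)
    (hv : ∀ i, t.points i ∈ Γ.carrier) (hq : maxEdge t ≤ ϱ * t.inradius)
    (hs : (2 * M * ϱ + M) * maxEdge t ≤ 1 / 2)
    {x y : E3} (hx : x ∈ convexHull ℝ (Set.range t.points))
    (hy : y ∈ convexHull ℝ (Set.range t.points)) :
    ‖(Γ.foot x - Γ.foot y) - (x - y)‖ ≤ 1 / 2 * ‖x - y‖ := by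
  obtain ⟨z, hz, he⟩ := h.exists_signedDist_sub hδ hv hx hy
  -- The increment of `d` is small since `x - y` is nearly orthogonal to `ν`; the increment of `ν`
  -- carries the small factor `d(y)`.
  have h1 : (Γ.foot x - Γ.foot y) - (x - y) =
      -((Γ.signedDist x - Γ.signedDist y) • Γ.normal x +
        Γ.signedDist y • (Γ.normal x - Γ.normal y)) := by
    simp only [foot, sub_smul, smul_sub]; abel
  rw [h1, norm_neg]
  refine (norm_add_le _ _).trans ?_
  rw [norm_smul, norm_smul, (h.tubular x (convexHull_subset hδ hv hx)).norm_normal, mul_one, he,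
    Real.norm_eq_abs, Real.norm_eq_abs]
  have h2 := h.abs_inner_normal_le hM hδ hv hq hz (t.sub_mem_vectorSpan hx hy)
  have h3 := abs_signedDist_le_maxEdge hv hy
  have h4 := h.norm_normal_sub_le (convex_convexHull ℝ _) (convexHull_subset hδ hv) hy hx
  calc _ ≤ 2 * M * ϱ * maxEdge t * ‖x - y‖ + maxEdge t * (M * ‖x - y‖) := by
        gcongr
        exact maxEdge_nonneg t
    _ = ((2 * M * ϱ + M) * maxEdge t) * ‖x - y‖ := by ring
    _ ≤ _ := by gcongr

theorem dist_foot_le (h : Γ.IsTube δ M) (hM : 0 ≤ M) (hδ : maxEdge t < δ)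
    (hv : ∀ i, t.points i ∈ Γ.carrier) (hq : maxEdge t ≤ ϱ * t.inradius)
    (hs : (2 * M * ϱ + M) * maxEdge t ≤ 1 / 2)
    {x y : E3} (hx : x ∈ convexHull ℝ (Set.range t.points))
    (hy : y ∈ convexHull ℝ (Set.range t.points)) :
    dist (Γ.foot x) (Γ.foot y) ≤ 2 * dist x y ∧ dist x y ≤ 2 * dist (Γ.foot x) (Γ.foot y) := by
  have h1 := h.norm_foot_sub_le hM hδ hv hq hs hx hy
  rw [dist_eq_norm, dist_eq_norm]
  have h2 := norm_sub_norm_le (Γ.foot x - Γ.foot y) (x - y)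
  have h3 := norm_sub_norm_le (x - y) (Γ.foot x - Γ.foot y)
  rw [norm_sub_rev (x - y) (Γ.foot x - Γ.foot y)] at h3
  have h4 := norm_nonneg (x - y)
  constructor <;> linarith

/-- Otherwise the unit vector `ν` would be parallel to the triangle, and its near-orthogonality to
the triangle would give `1 ≤ 2 * M * ϱ * maxEdge t ≤ 1 / 2`. -/
theorem inner_normal_ne_zero (h : Γ.IsTube δ M) (hM : 0 ≤ M) (hδ : maxEdge t < δ)
    (hv : ∀ i, t.points i ∈ Γ.carrier) (hq : maxEdge t ≤ ϱ * t.inradius)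
    (hs : (2 * M * ϱ + M) * maxEdge t ≤ 1 / 2)
    {x n : E3} (hx : x ∈ convexHull ℝ (Set.range t.points)) (hn : n ≠ 0)
    (hnt : ∀ i j, ⟪n, t.points i - t.points j⟫ = 0) : ⟪n, Γ.normal x⟫ ≠ 0 := by
  intro h0
  have hmem : Γ.normal x ∈ vectorSpan ℝ (Set.range t.points) := by
    rwa [t.vectorSpan_eq_orthogonal hn hnt, Submodule.mem_orthogonal_singleton_iff_inner_right]
  have h1 := h.abs_inner_normal_le hM hδ hv hq hx hmem
  rw [real_inner_self_eq_norm_sq, (h.tubular x (convexHull_subset hδ hv hx)).norm_normal] at h1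
  have h2 : 0 ≤ M * maxEdge t := mul_nonneg hM (maxEdge_nonneg t)
  norm_num at h1
  linarith

end ClosedC2Surface.IsTube

/-! ### Plane parametrisation of triangles and closability of the gradient -/

/-- In dimension two, interior points of the hull have positive barycentric coordinates. The upper
bound `1` demanded by `Affine.Simplex.interior` follows because the three sum to `1`. -/
theorem Affine.Simplex.interior_convexHull_subset {E : Type*} [NormedAddCommGroup E]
    [NormedSpace ℝ E] [FiniteDimensional ℝ E] (s : Affine.Simplex ℝ E 2)
    (hE : Module.finrank ℝ E = 2) :
    _root_.interior (convexHull ℝ (Set.range s.points)) ⊆ s.interior := by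
  let b : AffineBasis (Fin 3) ℝ E := ⟨s.points, s.independent,
    (s.independent.affineSpan_eq_top_iff_card_eq_finrank_add_one).2 (by simp [hE])⟩
  intro x hx
  have hx' : x ∈ _root_.interior (convexHull ℝ (Set.range b)) := hx
  rw [b.interior_convexHull] at hx'
  have hpos : ∀ i, 0 < b.coord i x := hx'
  have hsum := b.sum_coord_apply_eq_one x
  have hcomb := b.affineCombination_coord_eq_self x
  have hlt : ∀ i, b.coord i x < 1 := by
    rw [Fin.sum_univ_three] at hsum
    have h0 := hpos 0
    have h1 := hpos 1
    have h2 := hpos 2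
    intro i
    fin_cases i <;> simp only [Fin.mk_one, Fin.zero_eta, Fin.reduceFinMk] <;> linarith
  exact ⟨fun i => b.coord i x, hsum, fun i => ⟨hpos i, hlt i⟩, hcomb⟩

/-- Every triangle is the isometric image of a plane triangle. -/
theorem Affine.Triangle.exists_isometric_param (t : Affine.Triangle ℝ E3) :
    ∃ (L : EuclideanSpace ℝ (Fin 2) →ₗᵢ[ℝ] E3) (s : Affine.Triangle ℝ (EuclideanSpace ℝ (Fin 2))),
      (∀ i, t.points i = t.points 0 + L (s.points i)) ∧
        LinearMap.range L.toLinearMap = vectorSpan ℝ (Set.range t.points) := by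
  have hr : Module.finrank ℝ (vectorSpan ℝ (Set.range t.points)) = 2 :=
    t.independent.finrank_vectorSpan (Fintype.card_fin 3)
  let e := ((stdOrthonormalBasis ℝ (vectorSpan ℝ (Set.range t.points))).reindex
    (finCongr hr)).repr
  let L : EuclideanSpace ℝ (Fin 2) →ₗᵢ[ℝ] E3 :=
    (vectorSpan ℝ (Set.range t.points)).subtypeₗᵢ.comp e.symm.toLinearIsometry
  have hm : ∀ i, t.points i - t.points 0 ∈ vectorSpan ℝ (Set.range t.points) := fun i =>
    vsub_mem_vectorSpan ℝ ⟨i, rfl⟩ ⟨0, rfl⟩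
  let q : Fin 3 → EuclideanSpace ℝ (Fin 2) := fun i => e ⟨_, hm i⟩
  have hq : ∀ i, L (q i) = t.points i - t.points 0 := fun i => by simp [L, q]
  let f : EuclideanSpace ℝ (Fin 2) →ᵃ[ℝ] E3 :=
    L.toLinearMap.toAffineMap + AffineMap.const ℝ _ (t.points 0)
  have hf : f ∘ q = t.points := by
    ext1 i
    change L (q i) + t.points 0 = t.points i
    rw [hq]; abel
  refine ⟨L, ⟨q, AffineIndependent.of_comp f (by rw [hf]; exact t.independent)⟩, fun i => ?_, ?_⟩
  · rw [hq]; abel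
  · ext z
    simp only [LinearMap.mem_range]
    constructor
    · rintro ⟨y, rfl⟩
      exact (e.symm y).2
    · intro hz
      exact ⟨e ⟨z, hz⟩, by simp [L]⟩

/-- A parametrisation of a triangle by an open set of the plane, up to null sets. -/
theorem Affine.Triangle.exists_param (t : Affine.Triangle ℝ E3) :
    ∃ (L : EuclideanSpace ℝ (Fin 2) →ₗᵢ[ℝ] E3) (O : Set (EuclideanSpace ℝ (Fin 2))),
      LinearMap.range L.toLinearMap = vectorSpan ℝ (Set.range t.points) ∧ IsOpen O ∧
      volume O ≠ ∞ ∧ (∀ y ∈ O, t.points 0 + L y ∈ t.interior) ∧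
      surfaceMeasure (convexHull ℝ (Set.range t.points)) =
        (volume.restrict O).map (fun y => t.points 0 + L y) := by
  obtain ⟨L, s, hs, hL⟩ := t.exists_isometric_param
  let f : EuclideanSpace ℝ (Fin 2) →ᵃ[ℝ] E3 :=
    AffineMap.const ℝ _ (t.points 0) + L.toLinearMap.toAffineMap
  have hfL : (f : EuclideanSpace ℝ (Fin 2) → E3) = fun y => t.points 0 + L y := rfl
  have hiso : Isometry f := by
    rw [hfL]
    exact (IsometryEquiv.addLeft (t.points 0)).isometry.comp L.isometry
  have ht : s.map f hiso.injective = t := by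
    ext i : 1
    exact (hs i).symm
  have hC : convexHull ℝ (Set.range t.points) = f '' convexHull ℝ (Set.range s.points) := by
    rw [Affine.Simplex.convexHull_eq_closedInterior, Affine.Simplex.convexHull_eq_closedInterior,
      ← Affine.Simplex.closedInterior_map s hiso.injective, ht]
  have hconv := convex_convexHull ℝ (Set.range s.points)
  have hcpt : IsCompact (convexHull ℝ (Set.range s.points)) :=
    (Set.finite_range s.points).isCompact_convexHull ℝ
  refine ⟨L, _root_.interior (convexHull ℝ (Set.range s.points)), hL, isOpen_interior,
    ((measure_mono interior_subset).trans_lt hcpt.measure_lt_top).ne, ?_, ?_⟩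
  · intro y hy
    have h1 := s.interior_convexHull_subset (by simp) hy
    have h2 : t.interior = f '' s.interior := by
      rw [← Affine.Simplex.interior_map s hiso.injective, ht]
    rw [h2]
    exact ⟨y, h1, rfl⟩
  -- The frontier of a convex set is Lebesgue null, so the open triangle carries the full measure.
  · have hae : (_root_.interior (convexHull ℝ (Set.range s.points)) : Set _) =ᵐ[volume]
        convexHull ℝ (Set.range s.points) := by
      refine interior_subset.eventuallyLE.antisymm ?_
      rw [ae_le_set]
      refine measure_mono_null ?_ (hconv.addHaar_frontier volume)
      exact Set.sdiff_subset_sdiff_left subset_closure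
    rw [surfaceMeasure, hC, Measure.restrict_congr_set hae, ← hfL,
      ← EuclideanSpace.euclideanHausdorffMeasure_eq_volume]
    have hemb : MeasurableEmbedding f := hiso.isClosedEmbedding.measurableEmbedding
    have h1 := hemb.restrict_map μHE[2] (f '' convexHull ℝ (Set.range s.points))
    rw [hiso.map_euclideanHausdorffMeasure, Measure.restrict_restrict_of_subset
      (Set.image_subset_range _ _), Set.preimage_image_eq _ hiso.injective] at h1
    exact h1

theorem Affine.Triangle.ae_mem_interior (t : Affine.Triangle ℝ E3) :
    ∀ᵐ x ∂surfaceMeasure (convexHull ℝ (Set.range t.points)), x ∈ t.interior := by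
  obtain ⟨L, O, -, hO, -, hint, hm⟩ := t.exists_param
  rw [hm]
  have hemb : MeasurableEmbedding (fun y => t.points 0 + L y) :=
    ((IsometryEquiv.addLeft (t.points 0)).isometry.comp
      L.isometry).isClosedEmbedding.measurableEmbedding
  rw [hemb.ae_map_iff]
  exact (ae_restrict_mem hO.measurableSet).mono hint

theorem Affine.Triangle.surfaceMeasure_ne_top (t : Affine.Triangle ℝ E3) :
    surfaceMeasure (convexHull ℝ (Set.range t.points)) Set.univ ≠ ∞ := by
  obtain ⟨L, O, -, hO, hfin, -, hm⟩ := t.exists_param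
  have hc : Continuous (fun y => t.points 0 + L y) := by fun_prop
  rw [hm, Measure.map_apply hc.measurable MeasurableSet.univ]
  simpa using hfin

/-- The directional derivative is closable in `L²` of an open set of finite measure. -/
theorem ae_eq_zero_of_tendsto_fderiv {E : Type*} [NormedAddCommGroup E] [NormedSpace ℝ E]
    [FiniteDimensional ℝ E] [MeasurableSpace E] [BorelSpace E] {μ : Measure E}
    [μ.IsAddHaarMeasure] {O : Set E} (hO : IsOpen O) {ψ : ℕ → E → ℝ}
    (hψ : ∀ k, ContDiff ℝ 1 (ψ k)) (e : E) {g : E → ℝ} (hg : MemLp g 2 (μ.restrict O))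
    (h1 : Tendsto (fun k => eLpNorm (ψ k) 2 (μ.restrict O)) atTop (𝓝 0))
    (h2 : Tendsto (fun k => eLpNorm (fun y => fderiv ℝ (ψ k) y e - g y) 2 (μ.restrict O))
      atTop (𝓝 0)) :
    ∀ᵐ y ∂μ.restrict O, g y = 0 := by
  rw [ae_restrict_iff' hO.measurableSet]
  refine hO.ae_eq_zero_of_integral_contDiff_smul_eq_zero ?_ ?_
  · exact locallyIntegrableOn_of_locallyIntegrable_restrict (hg.locallyIntegrable (by norm_num))
  intro η hη hηc hηO
  have hη1 : ContDiff ℝ 1 η := hη.of_le (by exact_mod_cast le_top)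
  have hdη : Continuous fun y => fderiv ℝ η y e :=
    (hη1.continuous_fderiv (by simp)).clm_apply continuous_const
  have hdηc : HasCompactSupport fun y => fderiv ℝ η y e := hηc.fderiv_apply ℝ e
  have hηO0 : ∀ y, y ∉ O → η y = 0 := fun y hy =>
    image_eq_zero_of_notMem_tsupport fun h => hy (hηO h)
  have hdηO0 : ∀ y, y ∉ O → fderiv ℝ η y e = 0 := fun y hy => by
    have : fderiv ℝ η y = 0 := image_eq_zero_of_notMem_tsupport fun h =>
      hy (hηO (tsupport_fderiv_subset ℝ h))
    rw [this]; rfl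
  have hηL : MemLp η 2 (μ.restrict O) := (hη1.continuous.memLp_of_hasCompactSupport hηc).restrict O
  have hdηL : MemLp (fun y => fderiv ℝ η y e) 2 (μ.restrict O) :=
    (hdη.memLp_of_hasCompactSupport hdηc).restrict O
  have hdψ : ∀ k, Continuous fun y => fderiv ℝ (ψ k) y e := fun k =>
    ((hψ k).continuous_fderiv (by simp)).clm_apply continuous_const
  -- The test function has compact support in `O`, so both integrals extend to the whole space and
  -- no boundary term appears.
  have hparts : ∀ k, ∫ y in O, η y * fderiv ℝ (ψ k) y e ∂μ =
      -∫ y in O, fderiv ℝ η y e * ψ k y ∂μ := by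
    intro k
    rw [setIntegral_eq_integral_of_forall_compl_eq_zero fun y hy => by rw [hηO0 y hy, zero_mul],
      setIntegral_eq_integral_of_forall_compl_eq_zero fun y hy => by rw [hdηO0 y hy, zero_mul]]
    refine integral_mul_fderiv_eq_neg_fderiv_mul_of_integrable ?_ ?_ ?_
      (fun y _ => hη1.differentiable (by simp) y) (fun y _ => (hψ k).differentiable (by simp) y)
    · exact (hdη.mul (hψ k).continuous).integrable_of_hasCompactSupport hdηc.mul_right
    · exact (hη1.continuous.mul (hdψ k)).integrable_of_hasCompactSupport hηc.mul_right
    · exact (hη1.continuous.mul (hψ k).continuous).integrable_of_hasCompactSupport hηc.mul_right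
  have holder : ∀ {a b : E → ℝ}, AEStronglyMeasurable a (μ.restrict O) →
      AEStronglyMeasurable b (μ.restrict O) →
      ‖∫ y in O, a y * b y ∂μ‖ₑ ≤ eLpNorm a 2 (μ.restrict O) * eLpNorm b 2 (μ.restrict O) := by
    intro a b ha hb
    refine (enorm_integral_le_lintegral_enorm _).trans ?_
    rw [← eLpNorm_one_eq_lintegral_enorm]
    exact eLpNorm_smul_le_mul_eLpNorm (φ := a) (f := b) (p := 2) (q := 2) (r := 1) hb ha
  -- Only `∫ η g` is independent of `k`; both terms on the right tend to `0`, so it vanishes for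
  -- every test function `η`.
  have hbound : ∀ k, ‖∫ y in O, η y * g y ∂μ‖ₑ ≤
      eLpNorm η 2 (μ.restrict O) *
        eLpNorm (fun y => fderiv ℝ (ψ k) y e - g y) 2 (μ.restrict O) +
      eLpNorm (fun y => fderiv ℝ η y e) 2 (μ.restrict O) * eLpNorm (ψ k) 2 (μ.restrict O) := by
    intro k
    have hi1 : Integrable (fun y => η y * fderiv ℝ (ψ k) y e) (μ.restrict O) :=
      ((hη1.continuous.mul (hdψ k)).integrable_of_hasCompactSupport hηc.mul_right).restrict
    have hi2 : Integrable (fun y => η y * g y) (μ.restrict O) := hηL.integrable_mul hg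
    have hsplit : ∫ y in O, η y * g y ∂μ =
        -∫ y in O, fderiv ℝ η y e * ψ k y ∂μ -
          ∫ y in O, η y * (fderiv ℝ (ψ k) y e - g y) ∂μ := by
      simp only [mul_sub]
      rw [integral_sub hi1 hi2, hparts k]
      ring
    rw [hsplit, add_comm]
    refine (enorm_sub_le).trans (add_le_add ?_ ?_)
    · rw [enorm_neg]
      exact holder hdηL.1 (hψ k).continuous.aestronglyMeasurable
    · exact holder hηL.1 ((hdψ k).aestronglyMeasurable.sub hg.1)
  have hlim : Tendsto (fun k => eLpNorm η 2 (μ.restrict O) *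
        eLpNorm (fun y => fderiv ℝ (ψ k) y e - g y) 2 (μ.restrict O) +
      eLpNorm (fun y => fderiv ℝ η y e) 2 (μ.restrict O) * eLpNorm (ψ k) 2 (μ.restrict O))
      atTop (𝓝 0) := by
    have := (ENNReal.Tendsto.const_mul h2 (Or.inr hηL.2.ne)).add
      (ENNReal.Tendsto.const_mul h1 (Or.inr hdηL.2.ne))
    simpa using this
  have h0 : ‖∫ y in O, η y * g y ∂μ‖ₑ ≤ 0 := ge_of_tendsto' hlim hbound
  have h3 : ∫ y in O, η y * g y ∂μ = 0 := by simpa using h0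
  rw [← h3, setIntegral_eq_integral_of_forall_compl_eq_zero fun y hy => by rw [hηO0 y hy, zero_mul]]
  rfl

theorem eLpNorm_surfaceMeasure_mono {F : Type*} [NormedAddCommGroup F] {S T : Set E3} (h : S ⊆ T)
    (f : E3 → F) : eLpNorm f 2 (surfaceMeasure S) ≤ eLpNorm f 2 (surfaceMeasure T) :=
  eLpNorm_mono_measure f (Measure.restrict_mono h le_rfl)

theorem inner_tangentialProj_self {n : E3} (hn : ‖n‖ = 1) (v : E3) :
    ⟪n, tangentialProj n v⟫ = 0 := by
  rw [tangentialProj_apply, inner_sub_right, inner_smul_right, real_inner_self_eq_norm_sq, hn]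
  ring

theorem tangentialProj_eq_self {n v : E3} (h : ⟪n, v⟫ = 0) : tangentialProj n v = v := by
  rw [tangentialProj_apply, h, zero_smul, sub_zero]

/-- Limits of tangential gradients are tangential. -/
theorem ae_inner_eq_zero_of_tendsto {μ : Measure E3} {n : E3 → E3} {f : ℕ → E3 → E3} {G : E3 → E3}
    (hn : ∀ᵐ x ∂μ, ‖n x‖ = 1)
    (h : Tendsto (fun k => eLpNorm (fun x => tangentialProj (n x) (f k x) - G x) 2 μ) atTop (𝓝 0))
    (hm : AEStronglyMeasurable (fun x => ⟪n x, G x⟫) μ) : ∀ᵐ x ∂μ, ⟪n x, G x⟫ = 0 := by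
  have hb : ∀ k, eLpNorm (fun x => ⟪n x, G x⟫) 2 μ ≤
      eLpNorm (fun x => tangentialProj (n x) (f k x) - G x) 2 μ := by
    intro k
    refine eLpNorm_mono_ae ?_
    filter_upwards [hn] with x hx
    have h1 : ⟪n x, G x⟫ = -⟪n x, tangentialProj (n x) (f k x) - G x⟫ := by
      rw [inner_sub_right, inner_tangentialProj_self hx]; ring
    rw [h1, norm_neg]
    refine (norm_inner_le_norm _ _).trans ?_
    rw [hx, one_mul]
  have h0 : eLpNorm (fun x => ⟪n x, G x⟫) 2 μ ≤ 0 := ge_of_tendsto' h hb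
  exact (eLpNorm_eq_zero_iff hm (by norm_num)).1 (le_antisymm h0 bot_le)

/-- The tangential gradient is closable in `L²` of a triangle. -/
theorem Affine.Triangle.ae_eq_zero_of_tendsto (t : Affine.Triangle ℝ E3) {n : E3} (hn : ‖n‖ = 1)
    (hnt : ∀ i j, ⟪n, t.points i - t.points j⟫ = 0) {φ : ℕ → E3 → ℝ}
    (hφ : ∀ k, ContDiff ℝ 1 (φ k)) {G : E3 → E3}
    (hG : MemLp G 2 (surfaceMeasure (convexHull ℝ (Set.range t.points))))
    (h1 : Tendsto (fun k => eLpNorm (φ k) 2 (surfaceMeasure (convexHull ℝ (Set.range t.points))))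
      atTop (𝓝 0))
    (h2 : Tendsto (fun k => eLpNorm (fun x => tangentialProj n (∇ (φ k) x) - G x) 2
      (surfaceMeasure (convexHull ℝ (Set.range t.points)))) atTop (𝓝 0)) :
    ∀ᵐ x ∂surfaceMeasure (convexHull ℝ (Set.range t.points)), G x = 0 := by
  have hnormal := ae_inner_eq_zero_of_tendsto (n := fun _ => n) (ae_of_all _ fun _ => hn) h2
    (hG.1.const_inner (𝕜 := ℝ) (c := n))
  obtain ⟨L, O, hL, hO, hfin, -, hm⟩ := t.exists_param
  rw [hm] at hG h1 h2 hnormal ⊢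
  set f : EuclideanSpace ℝ (Fin 2) → E3 := fun y => t.points 0 + L y with hf
  have hemb : MeasurableEmbedding f :=
    ((IsometryEquiv.addLeft (t.points 0)).isometry.comp
      L.isometry).isClosedEmbedding.measurableEmbedding
  have hfd : ∀ y, HasFDerivAt f L.toContinuousLinearMap y := fun y =>
    L.toContinuousLinearMap.hasFDerivAt.const_add (t.points 0)
  have hfC : ContDiff ℝ 1 f := contDiff_const.add L.contDiff
  have hrange : ∀ z, ⟪n, z⟫ = 0 → ∃ e, L e = z := by
    intro z hz
    have : z ∈ vectorSpan ℝ (Set.range t.points) := by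
      rwa [t.vectorSpan_eq_orthogonal (norm_ne_zero_iff.1 (by simp [hn])) hnt,
        Submodule.mem_orthogonal_singleton_iff_inner_right]
    rw [← hL] at this
    exact this
  have horth : ∀ e, ⟪n, L e⟫ = 0 := by
    intro e
    have : L e ∈ vectorSpan ℝ (Set.range t.points) := by rw [← hL]; exact ⟨e, rfl⟩
    rwa [t.vectorSpan_eq_orthogonal (norm_ne_zero_iff.1 (by simp [hn])) hnt,
      Submodule.mem_orthogonal_singleton_iff_inner_right] at this
  rw [hemb.memLp_map_measure_iff] at hG
  simp only [hemb.eLpNorm_map_measure] at h1 h2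
  rw [hemb.ae_map_iff] at hnormal ⊢
  have hdir : ∀ e, ∀ᵐ y ∂volume.restrict O, ⟪G (f y), L e⟫ = 0 := by
    intro e
    refine ae_eq_zero_of_tendsto_fderiv hO (ψ := fun k => φ k ∘ f)
      (fun k => (hφ k).comp hfC) e ((MemLp.inner_const hG (L e))) h1 ?_
    have hle : ∀ k, eLpNorm (fun y => fderiv ℝ (φ k ∘ f) y e - ⟪G (f y), L e⟫) 2
        (volume.restrict O) ≤ ENNReal.ofReal ‖L e‖ *
        eLpNorm ((fun x => tangentialProj n (∇ (φ k) x) - G x) ∘ f) 2 (volume.restrict O) := by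
      intro k
      refine eLpNorm_le_mul_eLpNorm_of_ae_le_mul (ae_of_all _ fun y => ?_) 2
      have h3 : fderiv ℝ (φ k ∘ f) y e = ⟪tangentialProj n (∇ (φ k) (f y)), L e⟫ := by
        rw [inner_tangentialProj, tangentialProj_eq_self (horth e), inner_gradient,
          (((hφ k).differentiable (by simp) (f y)).hasFDerivAt.comp y (hfd y)).fderiv]
        rfl
      rw [h3, ← inner_sub_left, mul_comm]
      exact norm_inner_le_norm _ _
    refine tendsto_of_tendsto_of_tendsto_of_le_of_le tendsto_const_nhds ?_ (fun _ => bot_le) hle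
    have := ENNReal.Tendsto.const_mul h2 (Or.inr (ENNReal.ofReal_ne_top (r := ‖L e‖)))
    simpa using this
  -- Every tangential vector is `L e` for some `e`, so `G` is orthogonal to the plane of the
  -- triangle. As a limit of tangential fields it also lies in that plane, hence it is zero.
  have hall : ∀ z : E3, ∀ᵐ y ∂volume.restrict O, ⟪G (f y), tangentialProj n z⟫ = 0 := by
    intro z
    obtain ⟨e, he⟩ := hrange (tangentialProj n z) (inner_tangentialProj_self hn z)
    rw [← he]
    exact hdir e
  have hbasis : ∀ᵐ y ∂volume.restrict O, ∀ i : Fin 3,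
      ⟪G (f y), tangentialProj n (EuclideanSpace.basisFun (Fin 3) ℝ i)⟫ = 0 :=
    ae_all_iff.2 fun i => hall _
  filter_upwards [hbasis, hnormal] with y hy1 hy2
  rw [← tangentialProj_eq_self hy2]
  refine InnerProductSpace.ext_inner_right_basis (EuclideanSpace.basisFun (Fin 3) ℝ).toBasis
    fun i => ?_
  rw [OrthonormalBasis.coe_toBasis, inner_tangentialProj, hy1 i, inner_zero_left]

/-! ### Polyhedral surfaces and uniqueness of their tangential gradient -/

section Complex

variable {K : Geometry.SimplicialComplex ℝ E3}

theorem finite_triangles (hfin : K.faces.Finite) : (triangles K).Finite := by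
  have hV : (⋃ s ∈ K.faces, (s : Set E3)).Finite := hfin.biUnion fun s _ => s.finite_toSet
  have hF : {p : Fin 3 → E3 | ∀ i, p i ∈ ⋃ s ∈ K.faces, (s : Set E3)}.Finite := by
    simpa [Set.pi] using Set.Finite.pi' (fun _ : Fin 3 => hV)
  refine Set.Finite.of_finite_image (f := fun t : Affine.Triangle ℝ E3 => t.points)
    (hF.subset ?_) ?_
  · rintro _ ⟨t, ⟨s, hs, hst⟩, rfl⟩ i
    exact Set.mem_biUnion hs (by rw [hst]; exact ⟨i, rfl⟩)
  · intro t _ t' _ h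
    exact Affine.Simplex.ext (congrFun h)

theorem convexHull_subset_space {t : Affine.Triangle ℝ E3} (ht : t ∈ triangles K) :
    convexHull ℝ (Set.range t.points) ⊆ K.space := by
  obtain ⟨s, hs, hst⟩ := ht
  rw [← hst]
  exact K.convexHull_subset_space hs

theorem space_eq_biUnion
    (hp : ∀ s ∈ K.faces, ∃ t ∈ triangles K, (s : Set E3) ⊆ Set.range t.points) :
    K.space = ⋃ t ∈ triangles K, convexHull ℝ (Set.range t.points) := by
  refine subset_antisymm ?_ (Set.iUnion₂_subset fun t ht => convexHull_subset_space ht)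
  intro x hx
  obtain ⟨s, hs, hxs⟩ := K.mem_space_iff.1 hx
  obtain ⟨t, ht, hst⟩ := hp s hs
  exact Set.mem_biUnion ht (convexHull_mono hst hxs)

theorem isCompact_space (hfin : K.faces.Finite) : IsCompact K.space :=
  hfin.isCompact_biUnion fun s _ => s.finite_toSet.isCompact_convexHull ℝ

theorem maxEdge_le_meshSize (hfin : K.faces.Finite) {t : Affine.Triangle ℝ E3}
    (ht : t ∈ triangles K) : maxEdge t ≤ meshSize K :=
  le_csSup ((finite_triangles hfin).image maxEdge).bddAbove ⟨t, ht, rfl⟩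

theorem ae_surfaceMeasure_space_iff (hfin : K.faces.Finite)
    (hp : ∀ s ∈ K.faces, ∃ t ∈ triangles K, (s : Set E3) ⊆ Set.range t.points)
    {p : E3 → Prop} :
    (∀ᵐ x ∂surfaceMeasure K.space, p x) ↔ ∀ t ∈ triangles K,
      ∀ᵐ x ∂surfaceMeasure (convexHull ℝ (Set.range t.points)), p x := by
  rw [space_eq_biUnion hp]
  exact ae_restrict_biUnion_iff _ (finite_triangles hfin).countable p

theorem ae_exists_mem_interior (hfin : K.faces.Finite)
    (hp : ∀ s ∈ K.faces, ∃ t ∈ triangles K, (s : Set E3) ⊆ Set.range t.points) :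
    ∀ᵐ x ∂surfaceMeasure K.space, ∃ t ∈ triangles K, x ∈ t.interior := by
  rw [ae_surfaceMeasure_space_iff hfin hp]
  intro t ht
  filter_upwards [t.ae_mem_interior] with x hx using ⟨t, ht, hx⟩

/-- The prescribed normal may change sign from point to point inside a triangle, without any
measurability. Two unit normals of one plane agree up to sign, however, and `n nᵀ` does not see the
sign. -/
theorem tangentialProj_eq_of_mem_interior {νh : E3 → E3} (hν : IsDiscreteNormal K νh)
    {t : Affine.Triangle ℝ E3} (ht : t ∈ triangles K) {x y : E3} (hx : x ∈ t.interior)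
    (hy : y ∈ t.interior) : tangentialProj (νh x) = tangentialProj (νh y) := by
  obtain ⟨hx1, hx2⟩ := hν t ht x hx
  obtain ⟨hy1, hy2⟩ := hν t ht y hy
  have h0 : ∀ v, ⟪νh x, v⟫ = 0 ↔ ⟪νh y, v⟫ = 0 := by
    intro v
    rw [← Submodule.mem_orthogonal_singleton_iff_inner_right,
      ← Submodule.mem_orthogonal_singleton_iff_inner_right,
      ← t.vectorSpan_eq_orthogonal (norm_ne_zero_iff.1 (by simp [hx1])) hx2,
      ← t.vectorSpan_eq_orthogonal (norm_ne_zero_iff.1 (by simp [hy1])) hy2]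
  have h1 : tangentialProj (νh y) (νh x) = 0 := by
    rw [← inner_self_eq_zero (𝕜 := ℝ), inner_tangentialProj,
      tangentialProj_eq_self (inner_tangentialProj_self hy1 _), h0]
    exact inner_tangentialProj_self hy1 _
  rw [tangentialProj_apply, sub_eq_zero] at h1
  have h2 : ⟪νh y, νh x⟫ ^ 2 = 1 := by
    have h3 := congrArg norm h1
    rw [hx1, norm_smul, hy1, mul_one, Real.norm_eq_abs] at h3
    rw [← sq_abs, ← h3, one_pow]
  ext1 v
  rw [tangentialProj_apply, tangentialProj_apply]
  nth_rw 1 2 [h1]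
  rw [inner_smul_left, smul_smul, conj_trivial, mul_right_comm, ← pow_two, h2, one_mul]

/-- The tangential gradient on a polyhedral surface is unique. -/
theorem HasTangentialGradient.ae_eq (hfin : K.faces.Finite)
    (hp : ∀ s ∈ K.faces, ∃ t ∈ triangles K, (s : Set E3) ⊆ Set.range t.points)
    {νh : E3 → E3} (hν : IsDiscreteNormal K νh)
    {v : E3 → ℝ} {G G' : E3 → E3} (h : HasTangentialGradient K.space νh v G)
    (h' : HasTangentialGradient K.space νh v G') : ∀ᵐ x ∂surfaceMeasure K.space, G x = G' x := by
  obtain ⟨φ, hφ, hφ1, hφ2⟩ := h.approx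
  obtain ⟨φ', hφ', hφ1', hφ2'⟩ := h'.approx
  rw [ae_surfaceMeasure_space_iff hfin hp]
  intro t ht
  set μ := surfaceMeasure (convexHull ℝ (Set.range t.points)) with hμ
  have hsub := convexHull_subset_space ht
  have hμle : μ ≤ surfaceMeasure K.space := Measure.restrict_mono hsub le_rfl
  -- The incenter serves only as a reference point: its projection represents `P_h` on the whole
  -- open triangle.
  have hint := t.incenter_mem_interior
  obtain ⟨hn, hnt⟩ := hν t ht _ hint
  have hs1 : Tendsto (fun k => eLpNorm (fun x => φ k x - v x) 2 (surfaceMeasure K.space) +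
      eLpNorm (fun x => φ' k x - v x) 2 (surfaceMeasure K.space)) atTop (𝓝 0) := by
    simpa using hφ1.add hφ1'
  have hs2 := hφ2.add hφ2'
  rw [add_zero] at hs2
  have hae := t.ae_eq_zero_of_tendsto hn hnt (φ := fun k x => φ k x - φ' k x)
    (fun k => (hφ k).sub (hφ' k)) (G := fun x => G x - G' x)
    ((h.memLp_grad.sub h'.memLp_grad).mono_measure hμle) ?_ ?_
  · filter_upwards [hae] with x hx using sub_eq_zero.1 hx
  · refine tendsto_of_tendsto_of_tendsto_of_le_of_le tendsto_const_nhds hs1 (fun _ => bot_le)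
      fun k => (eLpNorm_surfaceMeasure_mono hsub _).trans ?_
    have : (fun x => φ k x - φ' k x) = (fun x => φ k x - v x) - fun x => φ' k x - v x := by
      ext x; simp
    rw [this]
    exact eLpNorm_sub_le ((hφ k).continuous.aestronglyMeasurable.sub h.memLp.1)
      ((hφ' k).continuous.aestronglyMeasurable.sub h.memLp.1) (by norm_num)
  · refine tendsto_of_tendsto_of_tendsto_of_le_of_le tendsto_const_nhds hs2 (fun _ => bot_le)
      fun k => ?_
    have e1 : (fun x => tangentialProj (νh t.incenter) (∇ (fun x => φ k x - φ' k x) x) -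
        (G x - G' x)) = (fun x => tangentialProj (νh t.incenter) (∇ (φ k) x) - G x) -
          fun x => tangentialProj (νh t.incenter) (∇ (φ' k) x) - G' x := by
      ext1 x
      have : ∇ (fun x => φ k x - φ' k x) x = ∇ (φ k) x - ∇ (φ' k) x := by
        refine ext_inner_right ℝ fun w => ?_
        rw [inner_sub_left, inner_gradient, inner_gradient, inner_gradient, fderiv_fun_sub
          ((hφ k).differentiable (by simp) x) ((hφ' k).differentiable (by simp) x)]
        rfl
      rw [this, map_sub]
      simp only [Pi.sub_apply]
      abel
    rw [e1]
    have e2 : ∀ (ψ : E3 → ℝ) (H : E3 → E3),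
        eLpNorm (fun x => tangentialProj (νh t.incenter) (∇ ψ x) - H x) 2 μ ≤
          eLpNorm (fun x => tangentialProj (νh x) (∇ ψ x) - H x) 2 (surfaceMeasure K.space) := by
      intro ψ H
      refine le_trans (le_of_eq (eLpNorm_congr_ae ?_)) (eLpNorm_surfaceMeasure_mono hsub _)
      filter_upwards [t.ae_mem_interior] with x hx
      rw [tangentialProj_eq_of_mem_interior hν ht hx hint]
    refine (eLpNorm_sub_le ?_ ?_ (by norm_num)).trans (add_le_add (e2 _ _) (e2 _ _))
    · exact ((tangentialProj _).continuous.comp (hφ k).continuous_gradient).aestronglyMeasurable.sub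
        (h.memLp_grad.mono_measure hμle).1
    · exact ((tangentialProj _).continuous.comp (hφ' k).continuous_gradient).aestronglyMeasurable.sub
        (h'.memLp_grad.mono_measure hμle).1

end Complex

/-! ### Area distortion of the lift and change of variables -/

theorem euclideanHausdorffMeasure_image_le {X Y : Type*} [MetricSpace X] [MeasurableSpace X]
    [BorelSpace X] [MetricSpace Y] [MeasurableSpace Y] [BorelSpace Y] {f : X → Y} {s : Set X}
    (h : ∀ x ∈ s, ∀ y ∈ s, dist (f x) (f y) ≤ 2 * dist x y) :
    μHE[2] (f '' s) ≤ 4 * μHE[2] s := by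
  have hL : LipschitzOnWith 2 f s := LipschitzOnWith.of_dist_le_mul h
  have h1 := hL.hausdorffMeasure_image_le (d := ((2 : ℕ) : ℝ)) (by positivity)
  rw [ENNReal.rpow_natCast] at h1
  simp only [Measure.euclideanHausdorffMeasure_def, Measure.smul_apply]
  have h2 : ((2 : NNReal) : ℝ≥0∞) ^ 2 = 4 := by norm_num
  rw [h2] at h1
  rw [ENNReal.smul_def, ENNReal.smul_def, smul_eq_mul, smul_eq_mul, mul_left_comm]
  gcongr

theorem le_euclideanHausdorffMeasure_image {X Y : Type*} [MetricSpace X] [MeasurableSpace X]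
    [BorelSpace X] [MetricSpace Y] [MeasurableSpace Y] [BorelSpace Y] {f : X → Y} {s : Set X}
    (h : ∀ x ∈ s, ∀ y ∈ s, dist x y ≤ 2 * dist (f x) (f y)) :
    μHE[2] s ≤ 4 * μHE[2] (f '' s) := by
  rcases s.eq_empty_or_nonempty with rfl | ⟨x₀, -⟩
  · simp
  have : Nonempty X := ⟨x₀⟩
  have hinj : Set.InjOn f s := fun x hx y hy hxy => by
    have h1 := h x hx y hy
    rw [hxy, dist_self, mul_zero] at h1
    exact dist_le_zero.1 h1
  have hinv : ∀ x ∈ s, Function.invFunOn f s (f x) = x := fun x hx => hinj.leftInvOn_invFunOn hx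
  have him : Function.invFunOn f s '' (f '' s) = s := by
    rw [Set.image_image]
    exact (Set.image_congr hinv).trans (Set.image_id' s)
  have h2 := euclideanHausdorffMeasure_image_le (f := Function.invFunOn f s) (s := f '' s) (by
    rintro _ ⟨x, hx, rfl⟩ _ ⟨y, hy, rfl⟩
    rw [hinv x hx, hinv y hy]
    exact h x hx y hy)
  rwa [him] at h2

/-- An admissible triangulation that is fine with respect to a tubular neighbourhood. -/
structure IsFine (Γ : ClosedC2Surface) (δ M ϱ : ℝ) (K : Geometry.SimplicialComplex ℝ E3) :
    Prop where
  tube : Γ.IsTube δ M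
  nonneg : 0 ≤ M
  mul_lt_one : δ * M < 1
  admissible : IsAdmissible Γ ϱ K
  maxEdge_lt : ∀ t ∈ triangles K, maxEdge t < δ
  maxEdge_small : ∀ t ∈ triangles K, (2 * M * ϱ + M) * maxEdge t ≤ 1 / 2

namespace IsFine

variable {Γ : ClosedC2Surface} {δ M ϱ : ℝ} {K : Geometry.SimplicialComplex ℝ E3}

theorem space_eq (h : IsFine Γ δ M ϱ K) :
    K.space = ⋃ t ∈ triangles K, convexHull ℝ (Set.range t.points) :=
  space_eq_biUnion h.admissible.pure

theorem isCompact (h : IsFine Γ δ M ϱ K) : IsCompact K.space := isCompact_space h.admissible.finite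

theorem space_subset (h : IsFine Γ δ M ϱ K) : K.space ⊆ Metric.thickening δ Γ.carrier := by
  rw [h.space_eq]
  exact Set.iUnion₂_subset fun t ht => ClosedC2Surface.IsTube.convexHull_subset (h.maxEdge_lt t ht)
    (h.admissible.interpolation t ht)

theorem lift_eq (h : IsFine Γ δ M ϱ K) {x : E3} (hx : x ∈ K.space) : Γ.lift x = Γ.foot x :=
  h.tube.lift_eq_foot (h.space_subset hx)

theorem isTubular (h : IsFine Γ δ M ϱ K) {x : E3} (hx : x ∈ K.space) : Γ.IsTubular x :=
  h.tube.tubular x (h.space_subset hx)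

theorem isLift_lift (h : IsFine Γ δ M ϱ K) {x : E3} (hx : x ∈ K.space) :
    Γ.IsLift x (Γ.lift x) :=
  (h.tube.isLift_iff (h.space_subset hx)).2 (h.lift_eq hx)

/-- Existence and uniqueness in the exact-cover condition give surjectivity and injectivity
respectively. -/
theorem bijOn_lift (h : IsFine Γ δ M ϱ K) : Set.BijOn Γ.lift K.space Γ.carrier := by
  refine ⟨fun x hx => (h.isLift_lift hx).1, fun x hx y hy hxy => ?_, fun p hp => ?_⟩
  · refine (h.admissible.simpleCover _ (h.isLift_lift hx).1).unique ⟨hx, h.isLift_lift hx⟩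
      ⟨hy, ?_⟩
    rw [hxy]
    exact h.isLift_lift hy
  · obtain ⟨x, ⟨hx, hxp⟩, -⟩ := h.admissible.simpleCover p hp
    exact ⟨x, hx, by rw [h.lift_eq hx, ← (h.tube.isLift_iff (h.space_subset hx)).1 hxp]⟩

theorem continuousOn_lift (h : IsFine Γ δ M ϱ K) : ContinuousOn Γ.lift K.space :=
  ContinuousOn.congr (fun _ hx => (h.isTubular hx).contDiffAt_foot.continuousAt.continuousWithinAt)
    fun _ hx => h.lift_eq hx

theorem dist_lift_le (h : IsFine Γ δ M ϱ K) {t : Affine.Triangle ℝ E3} (ht : t ∈ triangles K)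
    {x y : E3} (hx : x ∈ convexHull ℝ (Set.range t.points))
    (hy : y ∈ convexHull ℝ (Set.range t.points)) :
    dist (Γ.lift x) (Γ.lift y) ≤ 2 * dist x y ∧ dist x y ≤ 2 * dist (Γ.lift x) (Γ.lift y) := by
  rw [h.lift_eq (convexHull_subset_space ht hx), h.lift_eq (convexHull_subset_space ht hy)]
  exact h.tube.dist_foot_le h.nonneg (h.maxEdge_lt t ht) (h.admissible.interpolation t ht)
    (h.admissible.quasiUniform t ht) (h.maxEdge_small t ht) hx hy

/-- The bi-Lipschitz bound with constant `2` is available only on each triangle, where it distorts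
area by at most `2 ^ 2 = 4`. Summing over the triangles costs a factor equal to their number, and
overlaps are harmless for upper bounds. -/
theorem exists_measure_bounds (h : IsFine Γ δ M ϱ K) : ∃ C : ℝ≥0∞, C ≠ ∞ ∧ ∀ B ⊆ K.space,
    μHE[2] (Γ.lift '' B) ≤ C * μHE[2] B ∧ μHE[2] B ≤ C * μHE[2] (Γ.lift '' B) := by
  obtain ⟨F, hF⟩ := (finite_triangles h.admissible.finite).exists_finset_coe
  have hmem : ∀ t, t ∈ F ↔ t ∈ triangles K := fun t => by rw [← hF]; rfl
  refine ⟨F.card * 4, by finiteness, fun B hB => ?_⟩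
  have hcov : B = ⋃ t ∈ F, B ∩ convexHull ℝ (Set.range t.points) := by
    refine subset_antisymm (fun x hx => ?_) (Set.iUnion₂_subset fun t _ => Set.inter_subset_left)
    have hx' := hB hx
    rw [h.space_eq] at hx'
    obtain ⟨t, ht, hxt⟩ := Set.mem_iUnion₂.1 hx'
    exact Set.mem_biUnion ((hmem t).2 ht) ⟨hx, hxt⟩
  have h1 : ∀ t ∈ F, μHE[2] (Γ.lift '' (B ∩ convexHull ℝ (Set.range t.points))) ≤
      4 * μHE[2] (B ∩ convexHull ℝ (Set.range t.points)) := fun t ht =>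
    euclideanHausdorffMeasure_image_le fun x hx y hy =>
      (h.dist_lift_le ((hmem t).1 ht) hx.2 hy.2).1
  have h2 : ∀ t ∈ F, μHE[2] (B ∩ convexHull ℝ (Set.range t.points)) ≤
      4 * μHE[2] (Γ.lift '' (B ∩ convexHull ℝ (Set.range t.points))) := fun t ht =>
    le_euclideanHausdorffMeasure_image fun x hx y hy =>
      (h.dist_lift_le ((hmem t).1 ht) hx.2 hy.2).2
  constructor
  · calc μHE[2] (Γ.lift '' B)
        = μHE[2] (⋃ t ∈ F, Γ.lift '' (B ∩ convexHull ℝ (Set.range t.points))) := by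
          conv_lhs => rw [hcov, Set.image_iUnion₂]
      _ ≤ ∑ t ∈ F, μHE[2] (Γ.lift '' (B ∩ convexHull ℝ (Set.range t.points))) :=
          measure_biUnion_finset_le F _
      _ ≤ ∑ t ∈ F, 4 * μHE[2] B := Finset.sum_le_sum fun t ht => (h1 t ht).trans (by
          gcongr; exact Set.inter_subset_left)
      _ = _ := by rw [Finset.sum_const, nsmul_eq_mul, mul_assoc]
  · calc μHE[2] B = μHE[2] (⋃ t ∈ F, B ∩ convexHull ℝ (Set.range t.points)) := by
          conv_lhs => rw [hcov]
      _ ≤ ∑ t ∈ F, μHE[2] (B ∩ convexHull ℝ (Set.range t.points)) :=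
          measure_biUnion_finset_le F _
      _ ≤ ∑ t ∈ F, 4 * μHE[2] (Γ.lift '' B) := Finset.sum_le_sum fun t ht => (h2 t ht).trans (by
          gcongr; exact Set.inter_subset_left)
      _ = _ := by rw [Finset.sum_const, nsmul_eq_mul, mul_assoc]

theorem isFiniteMeasure_space (h : IsFine Γ δ M ϱ K) :
    IsFiniteMeasure (surfaceMeasure K.space) := by
  refine ⟨?_⟩
  rw [surfaceMeasure, Measure.restrict_apply MeasurableSet.univ, Set.univ_inter, h.space_eq]
  refine measure_biUnion_lt_top (finite_triangles h.admissible.finite) fun t _ => ?_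
  have := t.surfaceMeasure_ne_top
  rw [surfaceMeasure, Measure.restrict_apply MeasurableSet.univ, Set.univ_inter] at this
  exact this.lt_top

theorem isFiniteMeasure_carrier (h : IsFine Γ δ M ϱ K) :
    IsFiniteMeasure (surfaceMeasure Γ.carrier) := by
  obtain ⟨C, hC, hb⟩ := h.exists_measure_bounds
  have h1 := h.isFiniteMeasure_space.measure_univ_lt_top
  refine ⟨?_⟩
  rw [surfaceMeasure, Measure.restrict_apply MeasurableSet.univ, Set.univ_inter] at h1 ⊢
  rw [← h.bijOn_lift.image_eq]
  exact ((hb _ subset_rfl).1).trans_lt (ENNReal.mul_lt_top hC.lt_top h1)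

theorem aemeasurable_lift (h : IsFine Γ δ M ϱ K) : AEMeasurable Γ.lift (surfaceMeasure K.space) :=
  h.continuousOn_lift.aemeasurable h.isCompact.isClosed.measurableSet

theorem exists_map_lift_le (h : IsFine Γ δ M ϱ K) : ∃ C : ℝ≥0∞, C ≠ ∞ ∧
    (surfaceMeasure K.space).map Γ.lift ≤ C • surfaceMeasure Γ.carrier := by
  obtain ⟨C, hC, hb⟩ := h.exists_measure_bounds
  refine ⟨C, hC, Measure.le_iff.2 fun A hA => ?_⟩
  rw [Measure.map_apply_of_aemeasurable h.aemeasurable_lift hA, Measure.smul_apply, smul_eq_mul,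
    surfaceMeasure, surfaceMeasure, Measure.restrict_apply' h.isCompact.isClosed.measurableSet,
    Measure.restrict_apply hA]
  refine (hb _ Set.inter_subset_right).2.trans ?_
  gcongr
  rintro _ ⟨x, ⟨hxA, hx⟩, rfl⟩
  exact ⟨hxA, h.bijOn_lift.mapsTo hx⟩

theorem map_lift_absolutelyContinuous (h : IsFine Γ δ M ϱ K) :
    (surfaceMeasure K.space).map Γ.lift ≪ surfaceMeasure Γ.carrier := by
  obtain ⟨C, -, hb⟩ := h.exists_map_lift_le
  exact (Measure.absolutelyContinuous_of_le hb).trans Measure.smul_absolutelyContinuous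

theorem exists_eLpNorm_comp_lift_le (h : IsFine Γ δ M ϱ K) : ∃ C : ℝ≥0∞, C ≠ ∞ ∧
    ∀ {F : Type} [NormedAddCommGroup F] (f : E3 → F),
      AEStronglyMeasurable f (surfaceMeasure Γ.carrier) →
      eLpNorm (f ∘ Γ.lift) 2 (surfaceMeasure K.space) ≤
        C * eLpNorm f 2 (surfaceMeasure Γ.carrier) := by
  obtain ⟨C, hC, hb⟩ := h.exists_map_lift_le
  refine ⟨C ^ (1 / (2 : ℝ≥0∞)).toReal, by finiteness, fun f hf => ?_⟩
  rw [← eLpNorm_map_measure (hf.mono_ac h.map_lift_absolutelyContinuous) h.aemeasurable_lift]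
  refine (eLpNorm_mono_measure f hb).trans ?_
  rw [eLpNorm_smul_measure_of_ne_top (by norm_num), smul_eq_mul]

theorem invOn_lift (h : IsFine Γ δ M ϱ K) :
    Set.InvOn (Function.invFunOn Γ.lift K.space) Γ.lift K.space Γ.carrier :=
  h.bijOn_lift.invOn_invFunOn

/-- The lift is a continuous bijection from a compact set, so it maps closed subsets to closed sets
and its inverse is continuous on `Γ`. -/
theorem aemeasurable_invFunOn (h : IsFine Γ δ M ϱ K) :
    AEMeasurable (Function.invFunOn Γ.lift K.space) (surfaceMeasure Γ.carrier) := by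
  refine ContinuousOn.aemeasurable ?_ Γ.isClosed_carrier.measurableSet
  rw [continuousOn_iff_isClosed]
  intro t ht
  refine ⟨Γ.lift '' (K.space ∩ t), ?_, ?_⟩
  · exact ((h.isCompact.inter_right ht).image_of_continuousOn
      (h.continuousOn_lift.mono Set.inter_subset_left)).isClosed
  · ext p
    constructor
    · rintro ⟨hpt, hp⟩
      refine ⟨⟨_, ⟨?_, hpt⟩, h.invOn_lift.2 hp⟩, hp⟩
      exact h.bijOn_lift.surjOn.mapsTo_invFunOn hp
    · rintro ⟨⟨x, ⟨hx, hxt⟩, rfl⟩, hp⟩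
      refine ⟨?_, hp⟩
      rw [Set.mem_preimage, h.invOn_lift.1 hx]
      exact hxt

theorem unliftedMeasure_absolutelyContinuous (h : IsFine Γ δ M ϱ K) :
    unliftedMeasure Γ K ≪ surfaceMeasure K.space := by
  obtain ⟨C, -, hb⟩ := h.exists_measure_bounds
  refine Measure.AbsolutelyContinuous.mk fun B hB h0 => ?_
  rw [unliftedMeasure, Measure.map_apply_of_aemeasurable h.aemeasurable_invFunOn hB,
    surfaceMeasure, Measure.restrict_apply' Γ.isClosed_carrier.measurableSet]
  rw [surfaceMeasure, Measure.restrict_apply hB] at h0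
  refine measure_mono_null (t := Γ.lift '' (B ∩ K.space)) ?_ ?_
  · rintro p ⟨hpB, hp⟩
    exact ⟨_, ⟨hpB, h.bijOn_lift.surjOn.mapsTo_invFunOn hp⟩, h.invOn_lift.2 hp⟩
  · have := (hb _ (Set.inter_subset_right (s := B))).1
    rw [h0, mul_zero] at this
    exact le_antisymm this bot_le

theorem map_lift_unliftedMeasure (h : IsFine Γ δ M ϱ K) :
    (unliftedMeasure Γ K).map Γ.lift = surfaceMeasure Γ.carrier := by
  have h1 : AEMeasurable Γ.lift (unliftedMeasure Γ K) :=
    h.aemeasurable_lift.mono_ac h.unliftedMeasure_absolutelyContinuous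
  rw [unliftedMeasure] at h1 ⊢
  rw [AEMeasurable.map_map_of_aemeasurable h1 h.aemeasurable_invFunOn]
  refine (Measure.map_congr ?_).trans Measure.map_id
  filter_upwards [ae_restrict_mem (μ := μHE[2]) Γ.isClosed_carrier.measurableSet] with p hp
    using h.invOn_lift.2 hp

/-- Change of variables from the surface to the polyhedral surface. -/
theorem integral_lift (h : IsFine Γ δ M ϱ K) {f : E3 → ℝ}
    (hf : Integrable f (surfaceMeasure Γ.carrier)) :
    Integrable (fun x => measureQuotient Γ K x * f (Γ.lift x)) (surfaceMeasure K.space) ∧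
      ∫ x, f x ∂surfaceMeasure Γ.carrier =
        ∫ x, measureQuotient Γ K x * f (Γ.lift x) ∂surfaceMeasure K.space := by
  have hac := h.unliftedMeasure_absolutelyContinuous
  have := h.isFiniteMeasure_space
  have := h.isFiniteMeasure_carrier
  have : IsFiniteMeasure (unliftedMeasure Γ K) := by unfold unliftedMeasure; infer_instance
  have : (unliftedMeasure Γ K).HaveLebesgueDecomposition (surfaceMeasure K.space) :=
    Measure.haveLebesgueDecomposition_of_sigmaFinite _ _
  have h1 : AEMeasurable Γ.lift (unliftedMeasure Γ K) := h.aemeasurable_lift.mono_ac hac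
  -- Write `σ` as the image under the lift of the transported measure, which is absolutely
  -- continuous with density `μ_h`; the formula is then that of the Radon–Nikodym derivative.
  rw [← h.map_lift_unliftedMeasure] at hf
  constructor
  · exact (integrable_rnDeriv_smul_iff hac (f := f ∘ Γ.lift)).2 (hf.comp_aemeasurable h1)
  · rw [← h.map_lift_unliftedMeasure, integral_map h1 hf.1]
    exact (integral_rnDeriv_smul hac (f := f ∘ Γ.lift)).symm

end IsFine

/-! ### Transfer of gradients between the two surfaces -/

theorem norm_tangentialProj_le {n : E3} (hn : ‖n‖ = 1) (v : E3) :
    ‖tangentialProj n v‖ ≤ 2 * ‖v‖ := by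
  rw [tangentialProj_apply]
  refine (norm_sub_le _ _).trans ?_
  have := norm_inner_le_norm (𝕜 := ℝ) n v
  rw [norm_smul, hn, mul_one]
  rw [hn, one_mul] at this
  linarith

/-- Functions composed with the foot map are known to be `C¹` only in the tube, whereas approximants
must be `C¹` on all of `ℝ³`. Two nested shrinkings make the cutoff constant near each point of `C`
and near each point off `U`, so gradients on `C` are unaffected. -/
theorem exists_cutoff {C U : Set E3} (hC : IsClosed C) (hU : IsOpen U) (h : C ⊆ U) :
    ∃ χ : E3 → ℝ, ContDiff ℝ 1 χ ∧ (∀ x ∈ C, χ =ᶠ[𝓝 x] 1) ∧ ∀ x ∉ U, χ =ᶠ[𝓝 x] 0 := by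
  obtain ⟨V, hVo, hCV, hVU⟩ := normal_exists_closure_subset hC hU h
  obtain ⟨W, hWo, hVW, hWU⟩ := normal_exists_closure_subset isClosed_closure hU hVU
  obtain ⟨f, hf0, hf1, -⟩ := exists_contMDiffMap_zero_one_of_isClosed (n := 1)
    (modelWithCornersSelf ℝ E3) (s := Wᶜ) (t := closure V) hWo.isClosed_compl isClosed_closure
    (Set.disjoint_compl_left_iff_subset.2 hVW)
  refine ⟨f, f.contMDiff.contDiff, fun x hx => ?_, fun x hx => ?_⟩
  · filter_upwards [hVo.mem_nhds (hCV hx)] with y hy using hf1 (subset_closure hy)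
  · have : (closure W)ᶜ ∈ 𝓝 x := isClosed_closure.isOpen_compl.mem_nhds fun hxW => hx (hWU hxW)
    filter_upwards [this] with y hy using hf0 fun hyW => hy (subset_closure hyW)

namespace ClosedC2Surface.IsTubular

variable {Γ : ClosedC2Surface} {x : E3}

theorem inner_normal_shape (h : Γ.IsTubular x) (hn : ∀ᶠ y in 𝓝 x, Γ.IsTubular y) {g : E3}
    (hg : ⟪Γ.normal x, g⟫ = 0) :
    ⟪Γ.normal x, (1 - Γ.signedDist x • Γ.weingarten x) g⟫ = 0 := by
  rw [sub_apply, smul_apply, one_apply_eq_self, inner_sub_right, inner_smul_right,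
    ← h.inner_weingarten, h.weingarten_normal hn, hg, inner_zero_left]
  simp

theorem inner_shape (h : Γ.IsTubular x) (u v : E3) :
    ⟪(1 - Γ.signedDist x • Γ.weingarten x) u, v⟫ =
      ⟪u, (1 - Γ.signedDist x • Γ.weingarten x) v⟫ := by
  simp only [sub_apply, smul_apply, one_apply_eq_self, inner_sub_left, inner_sub_right,
    inner_smul_left, inner_smul_right, conj_trivial, h.inner_weingarten]

theorem shapeInv_shape (hu : IsUnit (1 - Γ.signedDist x • Γ.weingarten x)) (v : E3) :
    shapeInv Γ x ((1 - Γ.signedDist x • Γ.weingarten x) v) = v := by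
  have := Ring.inverse_mul_cancel _ hu
  exact congrArg (fun l : E3 →L[ℝ] E3 => l v) this

theorem shape_shapeInv (hu : IsUnit (1 - Γ.signedDist x • Γ.weingarten x)) (v : E3) :
    (1 - Γ.signedDist x • Γ.weingarten x) (shapeInv Γ x v) = v := by
  have := Ring.mul_inverse_cancel _ hu
  exact congrArg (fun l : E3 →L[ℝ] E3 => l v) this

theorem inner_shapeInv (h : Γ.IsTubular x)
    (hu : IsUnit (1 - Γ.signedDist x • Γ.weingarten x)) (u v : E3) :
    ⟪shapeInv Γ x u, v⟫ = ⟪u, shapeInv Γ x v⟫ := by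
  conv_lhs => rw [← shape_shapeInv hu v]
  rw [← h.inner_shape, shape_shapeInv hu]

end ClosedC2Surface.IsTubular

/-- `P_h q` differs from `q` by a multiple of `ν_h`. The oblique projection annihilates `ν_h` and
fixes every vector orthogonal to `ν`. -/
theorem obliqueProj_tangentialProj {Γ : ClosedC2Surface} {νh : E3 → E3} {x q : E3}
    (hn : ⟪νh x, Γ.normal (Γ.lift x)⟫ ≠ 0) (hq : ⟪Γ.normal (Γ.lift x), q⟫ = 0) :
    obliqueProj Γ νh x (tangentialProj (νh x) q) = q := by
  simp only [obliqueProj, outerProd, sub_apply, smul_apply, one_apply_eq_self,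
    InnerProductSpace.rankOne_apply]
  rw [tangentialProj_apply, inner_sub_right, inner_smul_right, hq, smul_smul,
    real_inner_comm (νh x) (Γ.normal (Γ.lift x)), zero_sub, mul_neg, mul_left_comm,
    inv_mul_cancel₀ hn, mul_one,
    neg_smul, sub_neg_eq_add, sub_add_cancel]

/-- The projection and `(I - d𝒜)⁻¹` are symmetric, so the left half of the product moves to the
second argument and a symmetric bilinear form appears. -/
theorem inner_ATilde {Γ : ClosedC2Surface} {K : Geometry.SimplicialComplex ℝ E3} {νh : E3 → E3}
    {x : E3} (h : Γ.IsTubular x) (hu : IsUnit (1 - Γ.signedDist x • Γ.weingarten x)) (a b : E3) :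
    ⟪ATilde Γ K νh x a, b⟫ = measureQuotient Γ K x *
      ⟪shapeInv Γ x (obliqueProj Γ νh x (tangentialProj (νh x) a)),
        shapeInv Γ x (obliqueProj Γ νh x (tangentialProj (νh x) b))⟫ := by
  simp only [ATilde, RTilde, ContinuousLinearMap.comp_apply, smul_apply, inner_smul_left,
    conj_trivial, inner_tangentialProj, ContinuousLinearMap.adjoint_inner_left, h.inner_shapeInv hu]

namespace IsFine

variable {Γ : ClosedC2Surface} {δ M ϱ : ℝ} {K : Geometry.SimplicialComplex ℝ E3} {νh : E3 → E3}

theorem isUnit (h : IsFine Γ δ M ϱ K) {x : E3} (hx : x ∈ K.space) :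
    IsUnit (1 - Γ.signedDist x • Γ.weingarten x) :=
  h.tube.isUnit h.mul_lt_one (h.space_subset hx)

theorem normal_lift (h : IsFine Γ δ M ϱ K) {x : E3} (hx : x ∈ K.space) :
    Γ.normal (Γ.lift x) = Γ.normal x := by
  rw [h.lift_eq hx, (h.isTubular hx).normal_foot]

theorem mem_space_of_mem_interior {t : Affine.Triangle ℝ E3} (ht : t ∈ triangles K) {x : E3}
    (hx : x ∈ t.interior) : x ∈ K.space := by
  refine convexHull_subset_space ht ?_
  rw [Affine.Simplex.convexHull_eq_closedInterior]
  exact t.interior_subset_closedInterior hx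

theorem inner_normal_ne_zero (h : IsFine Γ δ M ϱ K) (hν : IsDiscreteNormal K νh)
    {t : Affine.Triangle ℝ E3} (ht : t ∈ triangles K) {x : E3} (hx : x ∈ t.interior) :
    ⟪νh x, Γ.normal (Γ.lift x)⟫ ≠ 0 := by
  rw [h.normal_lift (mem_space_of_mem_interior ht hx)]
  obtain ⟨hn, hnt⟩ := hν t ht x hx
  refine h.tube.inner_normal_ne_zero h.nonneg (h.maxEdge_lt t ht) (h.admissible.interpolation t ht)
    (h.admissible.quasiUniform t ht) (h.maxEdge_small t ht) ?_ (norm_ne_zero_iff.1 (by simp [hn]))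
    hnt
  rw [Affine.Simplex.convexHull_eq_closedInterior]
  exact t.interior_subset_closedInterior hx

theorem ae_interior (h : IsFine Γ δ M ϱ K) :
    ∀ᵐ x ∂surfaceMeasure K.space, ∃ t ∈ triangles K, x ∈ t.interior :=
  ae_exists_mem_interior h.admissible.finite h.admissible.pure

theorem norm_shape_le (h : IsFine Γ δ M ϱ K) {x : E3} (hx : x ∈ K.space) (v : E3) :
    ‖(1 - Γ.signedDist x • Γ.weingarten x) v‖ ≤ 2 * ‖v‖ := by
  have h1 : |Γ.signedDist x| * ‖Γ.weingarten x‖ ≤ 1 :=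
    (mul_le_mul (ClosedC2Surface.IsTube.abs_signedDist_lt (h.space_subset hx)).le
      (h.tube.norm_weingarten_le x (h.space_subset hx)) (norm_nonneg _) h.tube.pos.le).trans
      h.mul_lt_one.le
  rw [sub_apply, smul_apply, one_apply_eq_self]
  refine (norm_sub_le _ _).trans ?_
  have h2 : ‖Γ.signedDist x • Γ.weingarten x v‖ ≤ 1 * ‖v‖ := by
    rw [norm_smul, Real.norm_eq_abs]
    calc _ ≤ |Γ.signedDist x| * (‖Γ.weingarten x‖ * ‖v‖) := by
          gcongr; exact (Γ.weingarten x).le_opNorm v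
      _ ≤ 1 * ‖v‖ := by rw [← mul_assoc]; gcongr
  linarith

theorem memLp_comp_lift (h : IsFine Γ δ M ϱ K) {F : Type} [NormedAddCommGroup F] {f : E3 → F}
    (hf : MemLp f 2 (surfaceMeasure Γ.carrier)) :
    MemLp (f ∘ Γ.lift) 2 (surfaceMeasure K.space) := by
  obtain ⟨C, hC, hb⟩ := h.exists_eLpNorm_comp_lift_le
  exact ⟨(hf.1.mono_ac h.map_lift_absolutelyContinuous).comp_aemeasurable h.aemeasurable_lift,
    (hb f hf.1).trans_lt (ENNReal.mul_lt_top hC.lt_top hf.2)⟩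

theorem aestronglyMeasurable_tangentialProj (h : IsFine Γ δ M ϱ K) (hν : IsDiscreteNormal K νh)
    {w : E3 → E3} (hw : AEStronglyMeasurable w (surfaceMeasure K.space)) :
    AEStronglyMeasurable (fun x => tangentialProj (νh x) (w x)) (surfaceMeasure K.space) := by
  have := (finite_triangles h.admissible.finite).countable.to_subtype
  have hle : ∀ t ∈ triangles K,
      surfaceMeasure (convexHull ℝ (Set.range t.points)) ≤ surfaceMeasure K.space := fun t ht =>
    Measure.restrict_mono (convexHull_subset_space ht) le_rfl
  have key : ∀ t : triangles K, AEStronglyMeasurable (fun x => tangentialProj (νh x) (w x))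
      (surfaceMeasure (convexHull ℝ (Set.range t.1.points))) := by
    rintro ⟨t, ht⟩
    refine ((tangentialProj (νh t.incenter)).continuous.comp_aestronglyMeasurable
      (hw.mono_measure (hle t ht))).congr ?_
    filter_upwards [t.ae_mem_interior] with x hx
    rw [tangentialProj_eq_of_mem_interior hν ht hx t.incenter_mem_interior]
  rw [surfaceMeasure, h.space_eq, Set.biUnion_eq_iUnion]
  exact aestronglyMeasurable_iUnion_iff.2 key

/-- Unlifting maps `H¹` functions to `H¹` functions. -/
theorem hasTangentialGradient_comp_lift (h : IsFine Γ δ M ϱ K) (hν : IsDiscreteNormal K νh)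
    {v : E3 → ℝ} {g : E3 → E3} (hv : HasTangentialGradient Γ.carrier Γ.normal v g) :
    HasTangentialGradient K.space νh (v ∘ Γ.lift) (fun x => tangentialProj (νh x)
      ((1 - Γ.signedDist x • Γ.weingarten x) (g (Γ.lift x)))) := by
  have hKm := h.isCompact.isClosed.measurableSet
  have hmem : ∀ᵐ x ∂surfaceMeasure K.space, x ∈ K.space := ae_restrict_mem hKm
  have hg := h.memLp_comp_lift hv.memLp_grad
  -- The constant `4` is a factor `2` for the projection times a factor `2` for `I - d𝒜`, where
  -- `‖d𝒜‖ ≤ 1`.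
  have hbound : ∀ x ∈ K.space, ‖νh x‖ = 1 → ∀ z, ‖tangentialProj (νh x)
      ((1 - Γ.signedDist x • Γ.weingarten x) z)‖ ≤ 4 * ‖z‖ := fun x hx hn z =>
    (norm_tangentialProj_le hn _).trans (by linarith [h.norm_shape_le hx z])
  have hunit : ∀ᵐ x ∂surfaceMeasure K.space, ‖νh x‖ = 1 := by
    filter_upwards [h.ae_interior] with x ⟨t, ht, hx⟩ using (hν t ht x hx).1
  have hshape : AEStronglyMeasurable (fun x => 1 - Γ.signedDist x • Γ.weingarten x)
      (surfaceMeasure K.space) := by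
    refine ContinuousOn.aestronglyMeasurable (fun x hx => ?_) hKm
    have hT := h.isTubular hx
    exact (continuousAt_const.sub
      (hT.contDiffAt.continuousAt.smul hT.continuousAt_weingarten)).continuousWithinAt
  obtain ⟨C, hC, hb⟩ := h.exists_eLpNorm_comp_lift_le
  obtain ⟨φ, hφ, hφ1, hφ2⟩ := hv.approx
  obtain ⟨χ, hχ, hχ1, hχ0⟩ := exists_cutoff h.isCompact.isClosed Metric.isOpen_thickening
    h.space_subset
  have hloc : ∀ k, ∀ x ∈ K.space, (fun y => χ y * φ k (Γ.foot y)) =ᶠ[𝓝 x] φ k ∘ Γ.foot := by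
    intro k x hx
    filter_upwards [hχ1 x hx] with y hy
    simp [hy]
  -- The approximants are the cut-off pullbacks of those on `Γ`. Near `Γ_h` they coincide with `φ k
  -- ∘ foot`, so their gradients are given by the chain rule.
  refine ⟨h.memLp_comp_lift hv.memLp, ?_, fun k y => χ y * φ k (Γ.foot y), fun k => ?_, ?_, ?_⟩
  · refine hg.of_le_mul (c := 4) (h.aestronglyMeasurable_tangentialProj hν ?_) ?_
    · exact (ContinuousLinearMap.id ℝ (E3 →L[ℝ] E3)).aestronglyMeasurable_comp₂ hshape hg.1
    · filter_upwards [hmem, hunit] with x hx hn using hbound x hx hn _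
  · rw [contDiff_iff_contDiffAt]
    intro x
    by_cases hx : x ∈ Metric.thickening δ Γ.carrier
    · exact hχ.contDiffAt.mul ((hφ k).contDiffAt.comp x (h.tube.tubular x hx).contDiffAt_foot)
    · refine contDiffAt_const (c := (0 : ℝ)) |>.congr_of_eventuallyEq ?_
      filter_upwards [hχ0 x hx] with y hy
      simp [hy]
  · have hlim := ENNReal.Tendsto.const_mul hφ1 (Or.inr hC)
    rw [mul_zero] at hlim
    refine tendsto_of_tendsto_of_tendsto_of_le_of_le tendsto_const_nhds hlim (fun _ => bot_le)
      fun k => le_trans (le_of_eq (eLpNorm_congr_ae ?_)) (hb (fun x => φ k x - v x)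
        ((hφ k).continuous.aestronglyMeasurable.sub hv.memLp.1))
    filter_upwards [hmem] with x hx
    have := (hloc k x hx).self_of_nhds
    simp only [Function.comp_apply] at this ⊢
    rw [this, h.lift_eq hx]
  · have hlim := ENNReal.Tendsto.const_mul (a := ENNReal.ofReal 4)
      (ENNReal.Tendsto.const_mul hφ2 (Or.inr hC)) (Or.inr ENNReal.ofReal_ne_top)
    rw [mul_zero, mul_zero] at hlim
    refine tendsto_of_tendsto_of_tendsto_of_le_of_le tendsto_const_nhds hlim (fun _ => bot_le)
      fun k => ?_
    have hm : AEStronglyMeasurable (fun x => tangentialProj (Γ.normal x) (∇ (φ k) x) - g x)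
        (surfaceMeasure Γ.carrier) := by
      refine AEStronglyMeasurable.sub ?_ hv.memLp_grad.1
      refine ContinuousOn.aestronglyMeasurable ?_ Γ.isClosed_carrier.measurableSet
      simp only [tangentialProj_apply]
      have hnc : ContinuousOn Γ.normal Γ.carrier := fun x hx =>
        (h.tube.isTubular_of_mem hx).contDiffAt_normal.continuousAt.continuousWithinAt
      have hgc := (hφ k).continuous_gradient.continuousOn (s := Γ.carrier)
      exact hgc.sub (ContinuousOn.smul (f := fun x => ⟪Γ.normal x, ∇ (φ k) x⟫)
        (hnc.inner (𝕜 := ℝ) hgc) hnc)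
    refine (eLpNorm_le_mul_eLpNorm_of_ae_le_mul ?_ 2).trans (mul_le_mul_right (hb _ hm) _)
    filter_upwards [hmem, hunit] with x hx hn
    rw [(hloc k x hx).gradient_eq, (h.isTubular hx).gradient_comp_foot
      (h.tube.eventually (h.space_subset hx)) ((hφ k).differentiable (by simp)), ← map_sub,
      ← map_sub, ← h.lift_eq hx, ← h.normal_lift hx]
    exact hbound x hx hn _

/-- The gradient on the surface is recovered from the gradient on the polyhedral surface. -/
theorem ae_shapeInv_obliqueProj (h : IsFine Γ δ M ϱ K) (hν : IsDiscreteNormal K νh)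
    {v : E3 → ℝ} {g G : E3 → E3} (hv : HasTangentialGradient Γ.carrier Γ.normal v g)
    (hV : HasTangentialGradient K.space νh (v ∘ Γ.lift) G) :
    ∀ᵐ x ∂surfaceMeasure K.space,
      shapeInv Γ x (obliqueProj Γ νh x (tangentialProj (νh x) (G x))) = g (Γ.lift x) := by
  have hΓm := Γ.isClosed_carrier.measurableSet
  obtain ⟨φ, hφ, -, hφ2⟩ := hv.approx
  have hnc : ContinuousOn Γ.normal Γ.carrier := fun x hx =>
    (h.tube.isTubular_of_mem hx).contDiffAt_normal.continuousAt.continuousWithinAt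
  have htan : ∀ᵐ p ∂surfaceMeasure Γ.carrier, ⟪Γ.normal p, g p⟫ = 0 := by
    refine ae_inner_eq_zero_of_tendsto ?_ hφ2
      ((hnc.aestronglyMeasurable hΓm).inner (𝕜 := ℝ) hv.memLp_grad.1)
    filter_upwards [ae_restrict_mem (μ := μHE[2]) hΓm] with p hp
      using (h.tube.isTubular_of_mem hp).norm_normal
  -- Tangentiality of `g` holds off a null set of `Γ`, and the area bounds make the preimage of that
  -- set null in `Γ_h`.
  have htan' := ae_of_ae_map h.aemeasurable_lift (h.map_lift_absolutelyContinuous.ae_le htan)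
  filter_upwards [htan', h.ae_interior, hV.ae_eq h.admissible.finite h.admissible.pure hν
    (h.hasTangentialGradient_comp_lift hν hv)] with x hx ⟨t, ht, hxt⟩ hG
  have hxK := mem_space_of_mem_interior ht hxt
  rw [h.normal_lift hxK] at hx
  have hq := (h.isTubular hxK).inner_normal_shape (h.tube.eventually (h.space_subset hxK)) hx
  rw [hG, tangentialProj_eq_self (inner_tangentialProj_self (hν t ht x hxt).1 _),
    obliqueProj_tangentialProj (h.inner_normal_ne_zero hν ht hxt) (by rwa [h.normal_lift hxK]),
    ClosedC2Surface.IsTubular.shapeInv_shape (h.isUnit hxK)]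

end IsFine

/-! ### The integral identity -/

theorem lemma5p1 (Γ : ClosedC2Surface) (ϱ : ℝ) :
    ∃ h₀ : ℝ, 0 < h₀ ∧
      ∀ K : Geometry.SimplicialComplex ℝ E3, IsAdmissible Γ ϱ K → meshSize K ≤ h₀ →
      ∀ νh : E3 → E3, IsDiscreteNormal K νh →
        -- the quantities in the identity are well defined
        (∀ x ∈ K.space, ∃! p, Γ.IsLift x p) ∧
        (∀ x ∈ K.space, IsUnit (1 - Γ.signedDist x • Γ.weingarten x)) ∧
        (∀ t ∈ triangles K, ∀ x ∈ t.interior, ⟪νh x, Γ.normal (Γ.lift x)⟫ ≠ 0) ∧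
        unliftedMeasure Γ K ≪ surfaceMeasure K.space ∧
        -- unlifting maps `H¹` to `H¹`
        (∀ v gv, HasTangentialGradient Γ.carrier Γ.normal v gv →
          ∃ Gv, HasTangentialGradient K.space νh (v ∘ Γ.lift) Gv) ∧
        -- the identity
        (∀ v w gv gw Gv Gw,
          HasTangentialGradient Γ.carrier Γ.normal v gv →
          HasTangentialGradient Γ.carrier Γ.normal w gw →
          HasTangentialGradient K.space νh (v ∘ Γ.lift) Gv →
          HasTangentialGradient K.space νh (w ∘ Γ.lift) Gw →
          Integrable (fun x => ⟪gv x, gw x⟫) (surfaceMeasure Γ.carrier) ∧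
          Integrable (fun x => ⟪ATilde Γ K νh x (Gv x), Gw x⟫) (surfaceMeasure K.space) ∧
          ∫ x, ⟪gv x, gw x⟫ ∂(surfaceMeasure Γ.carrier) =
            ∫ x, ⟪ATilde Γ K νh x (Gv x), Gw x⟫ ∂(surfaceMeasure K.space)) := by
  obtain ⟨δ, M, hT, hM, hδM⟩ := Γ.exists_isTube_mul_lt_one
  have hδ := hT.pos
  -- No sign of `ϱ` is assumed, hence the absolute value. In the bound on the mesh size, `c + 1`
  -- avoids division by zero and `δ / 2` makes the inequality `maxEdge t < δ` strict.
  set c : ℝ := 2 * M * |ϱ| + M with hc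
  have hc0 : 0 ≤ c := by positivity
  refine ⟨min (δ / 2) (1 / (2 * (c + 1))), by positivity, fun K hK hmesh νh hν => ?_⟩
  have h : IsFine Γ δ M ϱ K := by
    have hle : ∀ t ∈ triangles K, maxEdge t ≤ min (δ / 2) (1 / (2 * (c + 1))) := fun t ht =>
      (maxEdge_le_meshSize hK.finite ht).trans hmesh
    refine ⟨hT, hM, hδM, hK, fun t ht => ?_, fun t ht => ?_⟩
    · linarith [(hle t ht).trans (min_le_left _ _)]
    · have h1 := (hle t ht).trans (min_le_right _ _)
      have h2 := maxEdge_nonneg t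
      calc (2 * M * ϱ + M) * maxEdge t ≤ (c + 1) * (1 / (2 * (c + 1))) := by
            refine mul_le_mul ?_ h1 h2 (by positivity)
            have : 2 * M * ϱ ≤ 2 * M * |ϱ| := by gcongr; exact le_abs_self ϱ
            linarith
        _ = 1 / 2 := by field_simp
  refine ⟨fun x hx => hT.existsUnique_isLift (h.space_subset hx), fun x hx => h.isUnit hx,
    fun t ht x hx => h.inner_normal_ne_zero hν ht hx, h.unliftedMeasure_absolutelyContinuous,
    fun v gv hv => ⟨_, h.hasTangentialGradient_comp_lift hν hv⟩, ?_⟩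
  intro v w gv gw Gv Gw hv hw hV hW
  have hint : Integrable (fun x => ⟪gv x, gw x⟫) (surfaceMeasure Γ.carrier) :=
    (hv.memLp_grad.norm.integrable_mul hw.memLp_grad.norm).mono'
      (hv.memLp_grad.1.inner hw.memLp_grad.1) (ae_of_all _ fun x => norm_inner_le_norm _ _)
  obtain ⟨h1, h2⟩ := h.integral_lift hint
  have hae : (fun x => measureQuotient Γ K x * ⟪gv (Γ.lift x), gw (Γ.lift x)⟫)
      =ᵐ[surfaceMeasure K.space] fun x => ⟪ATilde Γ K νh x (Gv x), Gw x⟫ := by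
    filter_upwards [h.ae_shapeInv_obliqueProj hν hv hV, h.ae_shapeInv_obliqueProj hν hw hW,
      h.ae_interior] with x hx1 hx2 ⟨t, ht, hxt⟩
    have hxK := IsFine.mem_space_of_mem_interior ht hxt
    rw [inner_ATilde (h.isTubular hxK) (h.isUnit hxK), hx1, hx2]
  exact ⟨hint, h1.congr hae, h2.trans (integral_congr_ae hae)⟩
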